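/- Let $n>5$ be even and $m=\frac n2-2$. Let $u=(u_1,\dots,u_{n-2})$ be a vector with positive entries that is palindromic, i.e. $u_k=u_{n-1-k}$ for all $k$, and put $p(x)=\sum_{k=0}^{n-3}u_{k+1}x^k$. For $j=1,\dots,n$ let $u^j\in\mathbb R^n_+$ be the vector whose entries at the cyclically consecutive positions $j,j+1,\dots,j+n-3$ (modulo $n$) are $u_1,\dots,u_{n-2}$, and whose two other entries are $0$. A real symmetric $n\times n$ matrix $A$ is copositive if $x^TAx\ge 0$ for all $x\in\mathbb R^n_+$; let $\mathcal C^n$ be the cone of copositive matrices, $\mathcal S^n_+$ the cone of positive semi-definite matrices, and $\mathcal N^n$ the cone of symmetric element-wise nonnegative matrices. Set $$F_{\mathbf u}=\{A\in\mathcal C^n : (u^j)^TAu^j=0,\ j=1,\dots,n\},\qquad P_{\mathbf u}=\{A\in\mathcal S^n_+ : (u^j)^TAu^j=0,\ j=1,\dots,n\}.$$ Then $F_{\mathbf u}\neq P_{\mathbf u}$ if and only if there exist angles $0<\zeta_1<\dots<\zeta_m<\pi$ such that (a) the fractional part of $\frac{n\zeta_j}{4\pi}$ lies in $(0,\frac12)$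 for odd $j$ and in $(\frac12,1)$ for even $j$; (b) $p(x)$ is a positive multiple of $(x+1)\prod_{j=1}^m(x^2-2x\cos\zeta_j+1)$. For any such angles, the following hold. The cone $F_{\mathbf u}$ is linearly isomorphic to $\mathbb R^2_+$ and consists exactly of the symmetric circulant matrices $A$ (those invariant under simultaneous circular shifts of rows and columns) with $$A_{1k}=(-1)^{k-1}\lambda+c\sum_{j=1}^m\frac{\cos((k-1)\zeta_j)}{\sin\zeta_j\,\sin\frac{n\zeta_j}{2}\,\prod_{l\ne j}(\cos\zeta_j-\cos\zeta_l)},\qquad k=1,\dots,\tfrac n2+1,$$ for some $c,\lambda\ge 0$. The subset $P_{\mathbf u}$ consists exactly of those with $c=0$. Moreover, the matrix $A$ with $c=1,\lambda=0$ is exceptional (copositive, but not in $\mathcal S^n_++\mathcal N^n$) and extremal (it generates an extreme ray of $\mathcal C^n$), the matrix $P=((-1)^{i-j})_{i,j=1}^n$ is positive semi-definite of rank $1$, and $F_{\mathbf u}$ is the set of all combinations of these two matrices with nonnegative coefficients. -/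

import Mathlib

namespace CircCop

open Polynomial

/-- The cone of real copositive `n × n` matrices. -/
def copositiveCone (n : ℕ) : Set (Matrix (Fin n) (Fin n) ℝ) :=
  {A | A.IsSymm ∧ ∀ x : Fin n → ℝ, (∀ i, 0 ≤ x i) → 0 ≤ x ⬝ᵥ A.mulVec x}

/-- The cone of real symmetric positive semi-definite `n × n` matrices. -/
def psdCone (n : ℕ) : Set (Matrix (Fin n) (Fin n) ℝ) :=
  {A | A.PosSemidef}

/-- The cone of real symmetric element-wise nonnegative `n × n` matrices. -/
def nonnegCone (n : ℕ) : Set (Matrix (Fin n) (Fin n) ℝ) :=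
  {A | A.IsSymm ∧ ∀ i j, 0 ≤ A i j}

/-- A copositive matrix is exceptional if it is not the sum of a positive semi-definite and
a symmetric element-wise nonnegative matrix. -/
def IsExceptional {n : ℕ} (A : Matrix (Fin n) (Fin n) ℝ) : Prop :=
  A ∈ copositiveCone n ∧ ¬ ∃ P ∈ psdCone n, ∃ N ∈ nonnegCone n, A = P + N

/-- A copositive matrix is extremal if it generates an extreme ray of the copositive cone. -/
def IsExtremalCopositive {n : ℕ} (A : Matrix (Fin n) (Fin n) ℝ) : Prop :=
  A ∈ copositiveCone n ∧ A ≠ 0 ∧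
    ∀ B ∈ copositiveCone n, ∀ C ∈ copositiveCone n, A = B + C → ∃ β : ℝ, 0 ≤ β ∧ B = β • A

/-- The face of the copositive cone defined by a collection `U` of `n` vectors. -/
def copositiveFace {n : ℕ} (U : Fin n → Fin n → ℝ) : Set (Matrix (Fin n) (Fin n) ℝ) :=
  {A | A ∈ copositiveCone n ∧ ∀ j, U j ⬝ᵥ A.mulVec (U j) = 0}

/-- The face of the positive semi-definite cone defined by a collection `U` of `n` vectors. -/
def psdFace {n : ℕ} (U : Fin n → Fin n → ℝ) : Set (Matrix (Fin n) (Fin n) ℝ) :=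
  {A | A ∈ psdCone n ∧ ∀ j, U j ⬝ᵥ A.mulVec (U j) = 0}

/-- The collection of the `n` circular shifts of `u`, padded by two zeros: the vector number `j`
has the entries of `u`, in order, at the positions `j, j + 1, …, j + (n - 3)` modulo `n`
(the subtraction in `Fin n` is modulo `n`), and zeros at the two other positions. -/
def circulantZeros {n : ℕ} (u : Fin (n - 2) → ℝ) (j : Fin n) : Fin n → ℝ :=
  fun i => if h : ((i - j : Fin n) : ℕ) < n - 2 then u ⟨((i - j : Fin n) : ℕ), h⟩ else 0

/-- The polynomial whose coefficient vector is `u`. -/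
noncomputable def coeffPoly {d : ℕ} (u : Fin d → ℝ) : ℝ[X] :=
  ∑ k : Fin d, C (u k) * X ^ (k : ℕ)

/-- Increasing angles in `(0, π)` that satisfy the parity condition and the condition on the
polynomial with coefficient vector `u`. The angle number `j = 1, 2, …` of the usual numbering
is `ζ (j - 1)`, so that odd positions have even indices. -/
def AngleCondition (n : ℕ) {m : ℕ} (u : Fin (n - 2) → ℝ) (ζ : Fin m → ℝ) : Prop :=
  StrictMono ζ ∧
  (∀ j, ζ j ∈ Set.Ioo 0 Real.pi) ∧
  (∀ j : Fin m, (Even (j : ℕ) → Int.fract (n * ζ j / (4 * Real.pi)) ∈ Set.Ioo (0 : ℝ) (1 / 2)) ∧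
    (Odd (j : ℕ) → Int.fract (n * ζ j / (4 * Real.pi)) ∈ Set.Ioo (1 / 2 : ℝ) 1)) ∧
  ∃ α : ℝ, 0 < α ∧ coeffPoly u =
    C α * ((X + 1) * ∏ j, (X ^ 2 - C (2 * Real.cos (ζ j)) * X + 1))

/-- Invariance under simultaneous circular shifts of the row and column indices. -/
def IsCirculant {n : ℕ} (A : Matrix (Fin n) (Fin n) ℝ) : Prop :=
  ∀ i j k : Fin n, A (i + k) (j + k) = A i j

/-- The value of the entry number `k + 1` in the first row, as a function of the angles and of
the two parameters `c`, `lam`. -/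
noncomputable def rowFormula (n : ℕ) {m : ℕ} (ζ : Fin m → ℝ) (c lam : ℝ) (k : ℕ) : ℝ :=
  (-1) ^ k * lam + c * ∑ j : Fin m, Real.cos (k * ζ j) /
    (Real.sin (ζ j) * Real.sin (n * ζ j / 2) *
      ∏ l ∈ Finset.univ.erase j, (Real.cos (ζ j) - Real.cos (ζ l)))

/-- `A` is the symmetric circulant matrix whose first `n / 2 + 1` entries in the first row are
given by `rowFormula` with parameters `c`, `lam`. -/
def HasRowFormula {n m : ℕ} (ζ : Fin m → ℝ) (c lam : ℝ)
    (A : Matrix (Fin n) (Fin n) ℝ) : Prop :=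
  A.IsSymm ∧ IsCirculant A ∧
    ∀ i k : Fin n, (i : ℕ) = 0 → (k : ℕ) ≤ n / 2 → A i k = rowFormula n ζ c lam k

/-- The matrix with entries `(-1) ^ (i - j)`. -/
noncomputable def signMatrix (n : ℕ) : Matrix (Fin n) (Fin n) ℝ :=
  Matrix.of fun i j => (-1 : ℝ) ^ (((i : ℕ) : ℤ) - ((j : ℕ) : ℤ))

/-- Two cones are linearly isomorphic if some linear isomorphism of their linear spans maps one
onto the other. -/
def LinearlyIsomorphic {V W : Type*} [AddCommGroup V] [Module ℝ V] [AddCommGroup W] [Module ℝ W]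
    (K : Set V) (L : Set W) : Prop :=
  ∃ e : Submodule.span ℝ K ≃ₗ[ℝ] Submodule.span ℝ L,
    ∀ x : Submodule.span ℝ K, (x : V) ∈ K ↔ (e x : W) ∈ L

/-- The nonnegative quadrant in the plane. -/
def nonnegQuadrant : Set (Fin 2 → ℝ) := {x | ∀ i, 0 ≤ x i}

end CircCop

/-! Indices live in ℤ/n, u^j is the j-th padded shift of u, e_i is a unit vector and S is the cyclic
shift. The vector u^j vanishes exactly at j − 1 and j − 2; the other n − 2 positions form its
window. For A in the face, A is positive semi-definite on each window and A u^j lives on {j − 2, j −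
1}. Since u is palindromic and n is even, ∑ (−1)^j u^j = 0. With the symmetry of A this leaves a
single number: A u^j = α(e_{j−2} + e_{j−1}) with α ≥ 0 (`InFace.exists_const`). If α = 0, then A is
positive semi-definite, because adding multiples of the u^j moves any vector into a window. So the
two faces differ exactly when some A has α > 0.

Necessity of the factorization: summing A over all circular shifts makes it circulant. If p = (X −
ω)g, then, tested against window vectors, multiplication by X acts on g as the scalar ω. Shift
invariance then makes every root unimodular and simple, and excludes all n-th roots of unity except
−1 (`IsCircWitness.exists_angles`).

The explicit matrix T: let b(k) = ∑ w_j cos(kζ_j). Its Toeplitz form is ∑ w_j |∑ x_d e^{idζ_j}|²,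
and p gives a linear recurrence for b. Folding b into a circulant is harmless on windows if b(k) =
b(n − k) for 2 < k < n − 2. Lagrange interpolation of Chebyshev polynomials at the nodes cos ζ_j
shows that the stated weights achieve this, with b(2) − b(n − 2) > 0, which gives T a positive α. By
a sign count, the parity condition says that all w_j are positive. Copositivity follows by
subtracting from x ≥ 0 the largest admissible multiple of u^0.

The cone: a symmetric matrix killing all u^j has rows killed by p(S) and by S^n − 1, hence by S + 1,
so it is a multiple of the sign matrix P. Therefore A = cT + λP. Testing on cofactors of p isolates
λ and each c w_j, which gives the signs; extremality and exceptionality are read off from these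
coordinates. -/

namespace CircCop

open Polynomial

/-! ### Zeros of copositive quadratic forms -/

section QuadraticForm

variable {ι : Type*} [Fintype ι]

theorem dotProduct_mulVec_symm {A : Matrix ι ι ℝ} (hA : A.IsSymm) (x y : ι → ℝ) :
    x ⬝ᵥ A.mulVec y = y ⬝ᵥ A.mulVec x := by
  rw [Matrix.dotProduct_mulVec, ← Matrix.mulVec_transpose, hA.eq, dotProduct_comm]

theorem quadForm_add_smul {A : Matrix ι ι ℝ} (hA : A.IsSymm) (x y : ι → ℝ) (t : ℝ) :
    (x + t • y) ⬝ᵥ A.mulVec (x + t • y) =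
      x ⬝ᵥ A.mulVec x + 2 * t * (y ⬝ᵥ A.mulVec x) + t ^ 2 * (y ⬝ᵥ A.mulVec y) := by
  rw [Matrix.mulVec_add, Matrix.mulVec_smul, dotProduct_add, add_dotProduct, add_dotProduct,
    smul_dotProduct, smul_dotProduct, dotProduct_smul, dotProduct_smul,
    dotProduct_mulVec_symm hA x y]
  simp only [smul_eq_mul]
  ring

theorem nonneg_of_forall_linear_add_sq {a c : ℝ} (h : ∀ t : ℝ, 0 < t → 0 ≤ 2 * t * a + t ^ 2 * c) :
    0 ≤ a := by
  by_contra! ha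
  have hc : 0 < |c| + 1 := by positivity
  -- For this t one has t·c ≤ −a, so 2a + tc ≤ a < 0.
  have ht : 0 < -a / (|c| + 1) := div_pos (by linarith) hc
  have h1 := h _ ht
  have h2 : (-a / (|c| + 1)) * (|c| + 1) = -a := div_mul_cancel₀ _ hc.ne'
  have h3 : 0 ≤ 2 * a + (-a / (|c| + 1)) * c := by
    refine nonneg_of_mul_nonneg_right (a := -a / (|c| + 1)) ?_ ht
    linarith
  have h4 : (-a / (|c| + 1)) * c ≤ (-a / (|c| + 1)) * (|c| + 1) := by
    gcongr
    linarith [le_abs_self c]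
  linarith

variable [DecidableEq ι]

/-- At a zero of a copositive form the gradient is nonnegative. -/
theorem mulVec_nonneg_of_zero {A : Matrix ι ι ℝ} (hA : A.IsSymm)
    (hcop : ∀ x : ι → ℝ, (∀ i, 0 ≤ x i) → 0 ≤ x ⬝ᵥ A.mulVec x) {z : ι → ℝ} (hz : ∀ i, 0 ≤ z i)
    (hzA : z ⬝ᵥ A.mulVec z = 0) (i : ι) : 0 ≤ A.mulVec z i := by
  refine nonneg_of_forall_linear_add_sq
    (c := Pi.single i 1 ⬝ᵥ A.mulVec (Pi.single i 1)) fun t ht => ?_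
  have h := hcop (z + t • Pi.single i 1) fun k => by
    have : 0 ≤ (Pi.single i (1 : ℝ) : ι → ℝ) k := by
      by_cases hk : k = i
      · subst hk; simp
      · simp [hk]
    simp only [Pi.add_apply, Pi.smul_apply, smul_eq_mul]
    have := hz k
    positivity
  rw [quadForm_add_smul hA, hzA, single_one_dotProduct] at h
  linarith

/-- All summands z_k (Az)_k are nonnegative and their sum vanishes, so each of them vanishes. -/
theorem mulVec_eq_zero_of_zero {A : Matrix ι ι ℝ} (hA : A.IsSymm)
    (hcop : ∀ x : ι → ℝ, (∀ i, 0 ≤ x i) → 0 ≤ x ⬝ᵥ A.mulVec x) {z : ι → ℝ} (hz : ∀ i, 0 ≤ z i)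
    (hzA : z ⬝ᵥ A.mulVec z = 0) {i : ι} (hi : 0 < z i) : A.mulVec z i = 0 := by
  have h := (Finset.sum_eq_zero_iff_of_nonneg (s := Finset.univ)
    fun k _ => mul_nonneg (hz k) (mulVec_nonneg_of_zero hA hcop hz hzA k)).1 hzA i
      (Finset.mem_univ i)
  exact (mul_eq_zero.1 h).resolve_left hi.ne'

/-- A copositive form is nonnegative on all vectors supported in the support of one of its
zeros. -/
theorem quadForm_nonneg_of_zero {A : Matrix ι ι ℝ} (hA : A.IsSymm)
    (hcop : ∀ x : ι → ℝ, (∀ i, 0 ≤ x i) → 0 ≤ x ⬝ᵥ A.mulVec x) {z : ι → ℝ} (hz : ∀ i, 0 ≤ z i)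
    (hzA : z ⬝ᵥ A.mulVec z = 0) {x : ι → ℝ} (hx : ∀ i, z i = 0 → x i = 0) :
    0 ≤ x ⬝ᵥ A.mulVec x := by
  -- For small t > 0 the vector z + t x is still nonnegative: entries with z i = 0 do not move and
  -- the others start positive. The form there reduces to t² times its value at x.
  have hev : ∀ i, ∀ᶠ t in nhdsWithin (0 : ℝ) (Set.Ioi 0), 0 ≤ z i + t * x i := by
    intro i
    rcases (hz i).eq_or_lt with h | h
    · simp [hx i h.symm, ← h]
    · have hc : Filter.Tendsto (fun t : ℝ => z i + t * x i) (nhdsWithin 0 (Set.Ioi 0))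
          (nhds (z i + 0 * x i)) :=
        ((by fun_prop : Continuous fun t : ℝ => z i + t * x i).tendsto 0).mono_left
          nhdsWithin_le_nhds
      filter_upwards [hc.eventually (lt_mem_nhds (by simpa using h))] with t ht using ht.le
  obtain ⟨t, ht, ht0⟩ := ((Filter.eventually_all.2 hev).and self_mem_nhdsWithin).exists
  have h := hcop (z + t • x) ht
  have hxz : x ⬝ᵥ A.mulVec z = 0 := by
    refine Finset.sum_eq_zero fun i _ => ?_
    rcases (hz i).eq_or_lt with h | h
    · rw [hx i h.symm, zero_mul]
    · rw [mulVec_eq_zero_of_zero hA hcop hz hzA h, mul_zero]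
  rw [quadForm_add_smul hA, hzA, hxz] at h
  have ht2 : 0 < t ^ 2 := pow_pos ht0 2
  refine nonneg_of_mul_nonneg_right (a := t ^ 2) (by linarith) ht2

/-- Vectors on which a form vanishes, in the presence of semi-definiteness on a coordinate
subspace, are in the kernel of the corresponding principal submatrix. -/
theorem mulVec_eq_zero_of_quadForm_eq_zero {A : Matrix ι ι ℝ} (hA : A.IsSymm) {S : Set ι}
    (hS : ∀ x : ι → ℝ, (∀ i ∉ S, x i = 0) → 0 ≤ x ⬝ᵥ A.mulVec x) {x : ι → ℝ}
    (hx : ∀ i ∉ S, x i = 0) (hxA : x ⬝ᵥ A.mulVec x = 0) {i : ι} (hi : i ∈ S) :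
    A.mulVec x i = 0 := by
  have key : ∀ s : ℝ, 0 ≤ 2 * s * (A.mulVec x i) +
      s ^ 2 * (Pi.single i 1 ⬝ᵥ A.mulVec (Pi.single i 1)) := by
    intro s
    have h := hS (x + s • Pi.single i 1) fun k hk => by
      have hki : k ≠ i := fun h => hk (h ▸ hi)
      simp [hx k hk, hki]
    rw [quadForm_add_smul hA, hxA, single_one_dotProduct] at h
    linarith
  refine le_antisymm ?_ (nonneg_of_forall_linear_add_sq fun t _ => key t)
  have := nonneg_of_forall_linear_add_sq (a := -A.mulVec x i)
    (c := Pi.single i 1 ⬝ᵥ A.mulVec (Pi.single i 1)) fun t _ => by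
      have := key (-t); nlinarith
  linarith

end QuadraticForm

/-! ### Products of a matrix in the face with the generating zeros -/

section Cyclic

variable {n : ℕ}

theorem zmod_intCast_ne_zero (hn : 5 < n) {k : ℤ} (hk0 : k ≠ 0) (hk : |k| < 6) :
    (k : ZMod n) ≠ 0 := by
  rw [Ne, ZMod.intCast_zmod_eq_zero_iff_dvd]
  intro h
  have := Int.le_of_dvd (abs_pos.2 hk0) ((dvd_abs _ _).2 h)
  omega

/-- The circular shift of a function by `j`. -/
def shifted {R : Type*} (f : ZMod n → R) (j : ZMod n) : ZMod n → R := fun i => f (i - j)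

/-- The alternating sign on `ZMod n`. -/
def altSign (i : ZMod n) : ℝ := (-1) ^ i.val

theorem altSign_eq_or (i : ZMod n) : altSign i = 1 ∨ altSign i = -1 := neg_one_pow_eq_or ℝ _

theorem altSign_zero : altSign (0 : ZMod n) = 1 := by simp [altSign]

theorem altSign_mul_self (i : ZMod n) : altSign i * altSign i = 1 := by
  rcases altSign_eq_or i with h | h <;> simp [h]

theorem altSign_natCast (hne : Even n) (k : ℕ) : altSign (k : ZMod n) = (-1) ^ k := by
  rw [altSign, ZMod.val_natCast]
  conv_rhs => rw [← Nat.mod_add_div k n, pow_add, pow_mul, hne.neg_one_pow, one_pow, mul_one]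

theorem altSign_one (hne : Even n) : altSign (1 : ZMod n) = -1 := by
  simpa using altSign_natCast hne 1

theorem eq_of_two_periodic {b : ZMod n → ℝ} (hb : ∀ j, b (j + 2) = b j) (l : ℕ) (j : ZMod n) :
    b (j + 2 * l) = b j := by
  induction l with
  | zero => simp
  | succ l ih =>
    rw [show (j + 2 * ((l + 1 : ℕ) : ZMod n) : ZMod n) = j + 2 * l + 2 by push_cast; ring, hb, ih]

/-- A symmetric profile that is positive except at two adjacent positions of the cycle. -/
structure IsZeroProfile (f : ZMod n → ℝ) : Prop where
  neg_one : f (-1) = 0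
  neg_two : f (-2) = 0
  pos : ∀ d, d ≠ -1 → d ≠ -2 → 0 < f d
  symm : ∀ d, f (-3 - d) = f d

theorem IsZeroProfile.nonneg {f : ZMod n → ℝ} (hf : IsZeroProfile f) (d : ZMod n) : 0 ≤ f d := by
  by_cases h1 : d = -1
  · rw [h1, hf.neg_one]
  · by_cases h2 : d = -2
    · rw [h2, hf.neg_two]
    · exact (hf.pos d h1 h2).le

theorem IsZeroProfile.zero_pos (hn : 5 < n) {f : ZMod n → ℝ} (hf : IsZeroProfile f) : 0 < f 0 :=
  hf.pos 0
    (fun h => zmod_intCast_ne_zero hn (k := 1) (by norm_num) (by norm_num) (by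
      push_cast; linear_combination h))
    (fun h => zmod_intCast_ne_zero hn (k := 2) (by norm_num) (by norm_num) (by
      push_cast; linear_combination h))

theorem IsZeroProfile.shifted_pos {f : ZMod n → ℝ} (hf : IsZeroProfile f) {i j : ZMod n} (h1 : i ≠ j - 1)
    (h2 : i ≠ j - 2) : 0 < shifted f j i :=
  hf.pos _ (fun h => h1 (by linear_combination h)) fun h => h2 (by linear_combination h)

variable [NeZero n]

theorem altSign_add (hne : Even n) (i j : ZMod n) :
    altSign (i + j) = altSign i * altSign j := by
  obtain ⟨a, rfl⟩ : ∃ a : ℕ, (a : ZMod n) = i := ⟨i.val, ZMod.natCast_zmod_val i⟩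
  obtain ⟨b, rfl⟩ : ∃ b : ℕ, (b : ZMod n) = j := ⟨j.val, ZMod.natCast_zmod_val j⟩
  rw [← Nat.cast_add, altSign_natCast hne, altSign_natCast hne, altSign_natCast hne, pow_add]

theorem altSign_neg (hne : Even n) (i : ZMod n) : altSign (-i) = altSign i := by
  have h := altSign_add hne i (-i)
  rw [add_neg_cancel, altSign_zero] at h
  rcases altSign_eq_or i with h' | h' <;> rw [h'] at h ⊢ <;> linarith

theorem altSign_sub (hne : Even n) (i j : ZMod n) :
    altSign (i - j) = altSign i * altSign j := by
  rw [sub_eq_add_neg, altSign_add hne, altSign_neg hne]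

theorem altSign_add_one (hne : Even n) (i : ZMod n) : altSign (i + 1) = -altSign i := by
  rw [altSign_add hne, altSign_one hne]; ring

theorem altSign_sub_one (hne : Even n) (i : ZMod n) : altSign (i - 1) = -altSign i := by
  rw [altSign_sub hne, altSign_one hne]; ring

theorem exists_two_mul_of_altSign_eq_one {i : ZMod n} (h : altSign i = 1) :
    ∃ l : ℕ, i = 2 * l := by
  rw [altSign, neg_one_pow_eq_one_iff_even (by norm_num)] at h
  obtain ⟨l, hl⟩ := h
  refine ⟨l, ?_⟩
  rw [← ZMod.natCast_zmod_val i, hl]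
  push_cast
  ring

/-- Copositive matrices for which all circular shifts of `f` are zeros. -/
structure InFace (f : ZMod n → ℝ) (A : Matrix (ZMod n) (ZMod n) ℝ) : Prop where
  symm : A.IsSymm
  cop : ∀ x : ZMod n → ℝ, (∀ i, 0 ≤ x i) → 0 ≤ x ⬝ᵥ A.mulVec x
  zero : ∀ j, shifted f j ⬝ᵥ A.mulVec (shifted f j) = 0

variable {f : ZMod n → ℝ} {A : Matrix (ZMod n) (ZMod n) ℝ}

theorem InFace.mulVec_nonneg (hA : InFace f A) (hf : IsZeroProfile f) (i j : ZMod n) :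
    0 ≤ A.mulVec (shifted f j) i :=
  mulVec_nonneg_of_zero hA.symm hA.cop (fun _ => hf.nonneg _) (hA.zero j) i

theorem InFace.mulVec_eq_zero (hA : InFace f A) (hf : IsZeroProfile f) {i j : ZMod n}
    (h1 : i ≠ j - 1) (h2 : i ≠ j - 2) : A.mulVec (shifted f j) i = 0 :=
  mulVec_eq_zero_of_zero hA.symm hA.cop (fun _ => hf.nonneg _) (hA.zero j) (hf.shifted_pos h1 h2)

theorem InFace.quadForm_nonneg (hA : InFace f A) (hf : IsZeroProfile f) (j : ZMod n)
    {x : ZMod n → ℝ} (h1 : x (j - 1) = 0) (h2 : x (j - 2) = 0) : 0 ≤ x ⬝ᵥ A.mulVec x := by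
  refine quadForm_nonneg_of_zero hA.symm hA.cop (fun _ => hf.nonneg _) (hA.zero j) fun i hi => ?_
  by_cases h1' : i = j - 1
  · rw [h1', h1]
  · by_cases h2' : i = j - 2
    · rw [h2', h2]
    · exact absurd hi (hf.shifted_pos h1' h2').ne'

/-- The reflection d ↦ −3 − d preserves f and reverses the alternating sign, so the alternating sum
of f is its own negative. In vector form this is ∑ (−1)^j u^j = 0. -/
theorem sum_altSign_mul_shifted (hne : Even n) (hf : IsZeroProfile f) (i : ZMod n) :
    ∑ j, altSign j * shifted f j i = 0 := by
  have h1 : ∑ d : ZMod n, altSign d * f d = 0 := by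
    have h := (Equiv.subLeft (-3 : ZMod n)).sum_comp fun d => altSign d * f d
    have h2 : ∀ d : ZMod n, altSign (-3 - d) * f (-3 - d) = -(altSign d * f d) := by
      intro d
      rw [hf.symm, altSign_sub hne, altSign_neg hne]
      have : altSign (3 : ZMod n) = -1 := by
        have := altSign_natCast hne 3
        push_cast at this
        rw [this]; norm_num
      rw [this]; ring
    simp only [Equiv.subLeft_apply, h2, Finset.sum_neg_distrib] at h
    linarith
  have h := (Equiv.subLeft i).sum_comp fun j => altSign j * shifted f j i
  rw [← h]
  simp only [Equiv.subLeft_apply, shifted, sub_sub_cancel, altSign_sub hne, mul_assoc,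
    ← Finset.mul_sum, h1, mul_zero]

theorem dotProduct_eq_two_terms (hn : 5 < n) {v : ZMod n → ℝ} {j : ZMod n}
    (hv : ∀ i, i ≠ j - 1 → i ≠ j - 2 → v i = 0) (x : ZMod n → ℝ) :
    x ⬝ᵥ v = x (j - 2) * v (j - 2) + x (j - 1) * v (j - 1) := by
  have hne : (j - 2 : ZMod n) ≠ j - 1 := fun h =>
    zmod_intCast_ne_zero hn (k := 1) (by norm_num) (by norm_num) (by
      push_cast; linear_combination -h)
  rw [dotProduct, ← Finset.sum_subset (Finset.subset_univ {j - 2, j - 1}), Finset.sum_pair hne]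
  intro i _ hi
  simp only [Finset.mem_insert, Finset.mem_singleton, not_or] at hi
  rw [hv i hi.2 hi.1, mul_zero]

/-- The products of a matrix in the face with the generating zeros. -/
theorem InFace.exists_two_periodic (hn : 5 < n) (hne : Even n) (hA : InFace f A)
    (hf : IsZeroProfile f) :
    ∃ b : ZMod n → ℝ, (∀ j, b (j + 2) = b j) ∧ (∀ j, 0 ≤ b j) ∧
      ∀ x j, x ⬝ᵥ A.mulVec (shifted f j) = b j * x (j - 2) + b (j + 1) * x (j - 1) := by
  have hexp : ∀ x j, x ⬝ᵥ A.mulVec (shifted f j) =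
      x (j - 2) * A.mulVec (shifted f j) (j - 2) + x (j - 1) * A.mulVec (shifted f j) (j - 1) :=
    fun x j => dotProduct_eq_two_terms hn (fun i h1 h2 => hA.mulVec_eq_zero hf h1 h2) x
  have hf0 : 0 < f 0 := hf.zero_pos hn
  -- Evaluate the pairing of u^j and u^(j+1) under A in both orders. Each expansion meets one
  -- nonzero entry, f(−3) respectively f(0), and these are equal.
  have hcb : ∀ j, A.mulVec (shifted f (j + 1)) (j + 1 - 1) = A.mulVec (shifted f j) (j - 2) := by
    intro j
    have h := dotProduct_mulVec_symm hA.symm (shifted f (j + 1)) (shifted f j)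
    rw [hexp, hexp] at h
    simp only [shifted] at h
    rw [show (j - 2 - (j + 1) : ZMod n) = -3 - 0 by ring, show (j - 1 - (j + 1) : ZMod n) = -2 by ring,
      show (j + 1 - 2 - j : ZMod n) = -1 by ring, show (j + 1 - 1 - j : ZMod n) = 0 by ring,
      hf.symm, hf.neg_one, hf.neg_two, zero_mul, zero_mul, zero_add, add_zero] at h
    exact (mul_left_cancel₀ hf0.ne' h).symm
  -- The alternating sum of the vectors A u^j is zero. Its entry i involves only j = i + 1 and j = i
  -- + 2, which carry opposite signs.
  have hper : ∀ i, A.mulVec (shifted f (i + 2)) i = A.mulVec (shifted f (i + 1)) i := by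
    intro i
    have h0 : ∑ j, altSign j * A.mulVec (shifted f j) i = 0 := by
      simp only [Matrix.mulVec, dotProduct, Finset.mul_sum]
      rw [Finset.sum_comm]
      refine Finset.sum_eq_zero fun k _ => ?_
      have := sum_altSign_mul_shifted hne hf k
      calc ∑ j, altSign j * (A i k * shifted f j k)
          = A i k * ∑ j, altSign j * shifted f j k := by
            rw [Finset.mul_sum]; exact Finset.sum_congr rfl fun _ _ => by ring
        _ = 0 := by rw [this, mul_zero]
    have h1 := dotProduct_eq_two_terms hn (j := i + 3)
      (v := fun j => A.mulVec (shifted f j) i) (fun j h1 h2 => hA.mulVec_eq_zero hf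
        (fun h => h2 (by linear_combination -h)) (fun h => h1 (by linear_combination -h))) altSign
    rw [dotProduct, h0, show (i + 3 - 2 : ZMod n) = i + 1 by ring,
      show (i + 3 - 1 : ZMod n) = (i + 1) + 1 by ring, altSign_add_one hne (i + 1)] at h1
    rw [show (i + 1 + 1 : ZMod n) = i + 2 by ring] at h1
    have hs : altSign (i + 1) ≠ 0 := by
      intro h
      have := altSign_mul_self (i + 1)
      rw [h] at this
      norm_num at this
    refine mul_left_cancel₀ hs ?_
    linarith
  have hb2 : ∀ j, A.mulVec (shifted f (j + 2)) (j + 2 - 2) = A.mulVec (shifted f j) (j - 2) := by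
    intro j
    rw [← hcb j, show (j + 2 - 2 : ZMod n) = j by ring, show (j + 1 - 1 : ZMod n) = j by ring, hper]
  refine ⟨fun j => A.mulVec (shifted f j) (j - 2), hb2, fun j => hA.mulVec_nonneg hf _ _,
    fun x j => ?_⟩
  rw [hexp]
  have h : A.mulVec (shifted f (j + 1)) (j + 1 - 2) = A.mulVec (shifted f j) (j - 1) := by
    have h1 := hper (j - 1)
    rw [show (j - 1 + 2 : ZMod n) = j + 1 by ring, show (j - 1 + 1 : ZMod n) = j by ring] at h1
    rw [show (j + 1 - 2 : ZMod n) = j - 1 by ring, h1]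
  beta_reduce
  rw [h]
  ring

/-- If the profile consists of pairs of equal entries, then a matrix in the face annihilates the
generating zeros. -/
theorem InFace.eq_zero_of_paired (hn : 5 < n) (hne : Even n) (hA : InFace f A)
    (hf : IsZeroProfile f) (hpair : ∀ d, altSign d = 1 → f (d + 1) = f d) {b : ZMod n → ℝ}
    (hb2 : ∀ j, b (j + 2) = b j)
    (hb : ∀ x j, x ⬝ᵥ A.mulVec (shifted f j) = b j * x (j - 2) + b (j + 1) * x (j - 1))
    (j : ZMod n) : b j ≤ 0 := by
  -- Keep only the even positions of the profile. Pairing makes f the sum of `w` and its shift by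
  -- one, so that u^j = w^j + w^(j+1) for the shifts w^j of `w`.
  set w : ZMod n → ℝ := fun d => if altSign d = 1 then f d else 0 with hw
  have hodd : ∀ d, altSign d = -1 → w d = 0 := fun d hd => by
    simp only [hw, hd]; norm_num
  have heven : ∀ d, altSign d = 1 → w d = f d := fun d hd => by simp [hw, hd]
  have hnat : ∀ k : ℕ, altSign (-(k : ZMod n)) = (-1) ^ k := fun k => by
    rw [altSign_neg hne, altSign_natCast hne]
  have hw1 : w (-1) = 0 := hodd _ (by simpa using hnat 1)
  have hw3 : w (-3) = 0 := hodd _ (by have := hnat 3; push_cast at this; rw [this]; norm_num)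
  have hw5 : w (-5) = 0 := hodd _ (by have := hnat 5; push_cast at this; rw [this]; norm_num)
  have hs4 : altSign (-4 : ZMod n) = 1 := by
    have := hnat 4; push_cast at this; rw [this]; norm_num
  have hw2 : w (-2) = 0 := by
    rw [heven _ (by have := hnat 2; push_cast at this; rw [this]; norm_num), hf.neg_two]
  have hw4 : w (-4) = w 0 := by
    rw [heven _ hs4, heven _ altSign_zero, ← hpair _ hs4, ← hf.symm 0]
    congr 1
    ring
  have hw2pos : 0 < w 2 := by
    rw [heven _ (by have := altSign_natCast hne 2; push_cast at this; rw [this]; norm_num)]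
    refine hf.pos _ (fun h => ?_) (fun h => ?_)
    · exact zmod_intCast_ne_zero hn (k := 3) (by norm_num) (by norm_num) (by
        push_cast; linear_combination h)
    · exact zmod_intCast_ne_zero hn (k := 4) (by norm_num) (by norm_num) (by
        push_cast; linear_combination h)
  have hsum : ∀ j, shifted f j = shifted w j + shifted w (j + 1) := by
    intro j
    funext i
    simp only [shifted, Pi.add_apply]
    have hd : (i - (j + 1) : ZMod n) = (i - j) - 1 := by ring
    rw [hd]
    rcases altSign_eq_or (i - j) with h | h
    · rw [heven _ h, hodd _ (by rw [altSign_sub_one hne, h]), add_zero]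
    · have h' : altSign (i - j - 1) = 1 := by rw [altSign_sub_one hne, h, neg_neg]
      rw [hodd _ h, heven _ h', ← hpair _ h', zero_add, sub_add_cancel]
  have hrel : ∀ x j, x ⬝ᵥ A.mulVec (shifted w j) + x ⬝ᵥ A.mulVec (shifted w (j + 1)) =
      b j * x (j - 2) + b (j + 1) * x (j - 1) := by
    intro x j
    rw [← hb, hsum, Matrix.mulVec_add, dotProduct_add]
  -- Write G(i, k) for the pairing of w^i and w^k under A. The relations e telescope to G(j, j + 4)
  -- = G(j, j) + b(j) w(2), and the relations d to G(j + 4, j + 4) = G(j, j).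
  have e1 := hrel (shifted w j) j
  have e2 := hrel (shifted w (j + 1)) j
  have e3 := hrel (shifted w j) (j + 1)
  have e4 := hrel (shifted w j) (j + 1 + 1)
  have e5 := hrel (shifted w j) (j + 1 + 1 + 1)
  have d1 := hrel (shifted w (j + 1)) (j + 1)
  have d2 := hrel (shifted w (j + 1 + 1)) (j + 1)
  have d3 := hrel (shifted w (j + 1 + 1)) (j + 1 + 1)
  have d4 := hrel (shifted w (j + 1 + 1 + 1)) (j + 1 + 1)
  have d5 := hrel (shifted w (j + 1 + 1 + 1)) (j + 1 + 1 + 1)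
  have d6 := hrel (shifted w (j + 1 + 1 + 1 + 1)) (j + 1 + 1 + 1)
  rw [dotProduct_mulVec_symm hA.symm (shifted w (j + 1)) (shifted w j)] at e2
  rw [dotProduct_mulVec_symm hA.symm (shifted w (j + 1 + 1)) (shifted w (j + 1))] at d2
  rw [dotProduct_mulVec_symm hA.symm (shifted w (j + 1 + 1 + 1)) (shifted w (j + 1 + 1))] at d4
  rw [dotProduct_mulVec_symm hA.symm (shifted w (j + 1 + 1 + 1 + 1))
    (shifted w (j + 1 + 1 + 1))] at d6
  have hbb : b (j + 1 + 1 + 1 + 1) = b j := by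
    rw [show (j + 1 + 1 + 1 + 1 : ZMod n) = j + 2 + 2 by ring, hb2, hb2]
  have val : ∀ i k d : ZMod n, i - k = d → shifted w k i = w d := fun i k d h => by
    rw [shifted, h]
  rw [val (j - 2) j (-2) (by ring), val (j - 1) j (-1) (by ring), hw1, hw2] at e1
  rw [val (j - 2) (j + 1) (-3) (by ring), val (j - 1) (j + 1) (-2) (by ring), hw2, hw3] at e2
  rw [val (j + 1 - 2) j (-1) (by ring), val (j + 1 - 1) j 0 (by ring), hw1] at e3
  rw [val (j + 1 + 1 - 2) j 0 (by ring), val (j + 1 + 1 - 1) j 1 (by ring)] at e4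
  rw [val (j + 1 + 1 + 1 - 2) j 1 (by ring), val (j + 1 + 1 + 1 - 1) j 2 (by ring), hbb] at e5
  rw [val (j + 1 - 2) (j + 1) (-2) (by ring), val (j + 1 - 1) (j + 1) (-1) (by ring), hw1,
    hw2] at d1
  rw [val (j + 1 - 2) (j + 1 + 1) (-3) (by ring), val (j + 1 - 1) (j + 1 + 1) (-2) (by ring), hw2,
    hw3] at d2
  rw [val (j + 1 + 1 - 2) (j + 1 + 1) (-2) (by ring),
    val (j + 1 + 1 - 1) (j + 1 + 1) (-1) (by ring), hw1, hw2] at d3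
  rw [val (j + 1 + 1 - 2) (j + 1 + 1 + 1) (-3) (by ring),
    val (j + 1 + 1 - 1) (j + 1 + 1 + 1) (-2) (by ring), hw2, hw3] at d4
  rw [val (j + 1 + 1 + 1 - 2) (j + 1 + 1 + 1) (-2) (by ring),
    val (j + 1 + 1 + 1 - 1) (j + 1 + 1 + 1) (-1) (by ring), hw1, hw2] at d5
  rw [val (j + 1 + 1 + 1 - 2) (j + 1 + 1 + 1 + 1) (-3) (by ring),
    val (j + 1 + 1 + 1 - 1) (j + 1 + 1 + 1 + 1) (-2) (by ring), hw2, hw3] at d6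
  -- The difference of w^j and w^(j+4) vanishes at j and j − 1, the two zeros of u^(j+1), because
  -- w(−4) = w(0). Its value −2 b(j) w(2) is therefore nonnegative.
  have hpos := hA.quadForm_nonneg hf (j + 1)
    (x := shifted w j + (-1 : ℝ) • shifted w (j + 1 + 1 + 1 + 1))
    (by
      simp only [Pi.add_apply, Pi.smul_apply, smul_eq_mul]
      rw [val (j + 1 - 1) j 0 (by ring), val (j + 1 - 1) (j + 1 + 1 + 1 + 1) (-4) (by ring), hw4]
      ring)
    (by
      simp only [Pi.add_apply, Pi.smul_apply, smul_eq_mul]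
      rw [val (j + 1 - 2) j (-1) (by ring), val (j + 1 - 2) (j + 1 + 1 + 1 + 1) (-5) (by ring), hw1,
        hw5]
      ring)
  rw [quadForm_add_smul hA.symm, dotProduct_mulVec_symm hA.symm (shifted w (j + 1 + 1 + 1 + 1))
    (shifted w j)] at hpos
  have hle : b j * w 2 ≤ 0 := by linarith
  exact nonpos_of_mul_nonpos_left hle hw2pos

/-- For every matrix in the face the products with the generating zeros are circulant, and governed
by a single nonnegative number. -/
theorem InFace.exists_const (hn : 5 < n) (hne : Even n) (hA : InFace f A)
    (hf : IsZeroProfile f) :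
    ∃ α : ℝ, 0 ≤ α ∧
      ∀ x j, x ⬝ᵥ A.mulVec (shifted f j) = α * (x (j - 2) + x (j - 1)) := by
  obtain ⟨b, hb2, hb0, hb⟩ := hA.exists_two_periodic hn hne hf
  have hb01 : b 0 = b 1 := by
    -- If b 0 ≠ b 1, symmetry of the pairing of u^0 with u^(d+2) for even d forces f(d + 1) = f(d).
    -- In that paired case b ≤ 0, hence b 0 = b 1 = 0, a contradiction.
    by_contra hne01
    have hpair : ∀ d, altSign d = 1 → f (d + 1) = f d := by
      intro d hd
      obtain ⟨l, hl⟩ := exists_two_mul_of_altSign_eq_one hd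
      have h := dotProduct_mulVec_symm hA.symm (shifted f 0) (shifted f (d + 2))
      rw [hb, hb] at h
      simp only [shifted] at h
      have hbd : b (d + 2) = b 0 := by
        rw [hb2, hl]
        simpa using eq_of_two_periodic hb2 l 0
      have hbd1 : b (d + 2 + 1) = b 1 := by
        rw [show (d + 2 + 1 : ZMod n) = 1 + d + 2 by ring, hb2, hl, eq_of_two_periodic hb2]
      rw [hbd, hbd1, show (d + 2 - 2 - 0 : ZMod n) = d by ring,
        show (d + 2 - 1 - 0 : ZMod n) = d + 1 by ring,
        show (0 - 2 - (d + 2) : ZMod n) = -3 - (d + 1) by ring,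
        show (0 - 1 - (d + 2) : ZMod n) = -3 - d by ring, hf.symm, hf.symm, zero_add] at h
      have h' : (b 0 - b 1) * (f (d + 1) - f d) = 0 := by linear_combination -h
      have := (mul_eq_zero.1 h').resolve_left (sub_ne_zero.2 hne01)
      linarith
    have h0 := hA.eq_zero_of_paired hn hne hf hpair hb2 hb 0
    have h1 := hA.eq_zero_of_paired hn hne hf hpair hb2 hb 1
    exact hne01 (by linarith [hb0 0, hb0 1])
  have hconst : ∀ j, b j = b 0 := by
    intro j
    rcases altSign_eq_or j with h | h
    · obtain ⟨l, hl⟩ := exists_two_mul_of_altSign_eq_one h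
      rw [hl]
      simpa using eq_of_two_periodic hb2 l 0
    · obtain ⟨l, hl⟩ := exists_two_mul_of_altSign_eq_one (i := j - 1)
        (by rw [altSign_sub_one hne, h, neg_neg])
      rw [show j = 1 + 2 * l by rw [← hl]; ring, eq_of_two_periodic hb2, hb01]
  refine ⟨b 0, hb0 0, fun x j => ?_⟩
  rw [hb, hconst j, hconst (j + 1)]
  ring

/-- Matrices in the face that annihilate the generating zeros are positive semi-definite. -/
theorem InFace.quadForm_nonneg_of_annihilates (hn : 5 < n) (hA : InFace f A)
    (hf : IsZeroProfile f) (h0 : ∀ j, A.mulVec (shifted f j) = 0) (x : ZMod n → ℝ) :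
    0 ≤ x ⬝ᵥ A.mulVec x := by
  have hinv : ∀ (x : ZMod n → ℝ) (j : ZMod n) (t : ℝ),
      (x + t • shifted f j) ⬝ᵥ A.mulVec (x + t • shifted f j) = x ⬝ᵥ A.mulVec x := by
    intro x j t
    rw [quadForm_add_smul hA.symm, dotProduct_mulVec_symm hA.symm (shifted f j) x, h0]
    simp
  have hne : ∀ k : ℤ, k ≠ 0 → |k| < 6 → (k : ZMod n) ≠ 0 := fun k => zmod_intCast_ne_zero hn
  have hp1 : 0 < shifted f 2 (-1) := hf.shifted_pos
    (fun h => hne 2 (by norm_num) (by norm_num) (by push_cast; linear_combination -h))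
    (fun h => hne 1 (by norm_num) (by norm_num) (by push_cast; linear_combination -h))
  have hp2 : 0 < shifted f 1 (-2) := hf.shifted_pos
    (fun h => hne 2 (by norm_num) (by norm_num) (by push_cast; linear_combination -h))
    (fun h => hne 1 (by norm_num) (by norm_num) (by push_cast; linear_combination -h))
  have hz : shifted f 1 (-1) = 0 := by rw [shifted, ← hf.neg_two]; congr 1; ring
  -- First u^2 clears the entry at −1; then u^1, which already vanishes there, clears the entry at
  -- −2. The result lies in the window of u^0.
  set y := x + (-x (-1) / shifted f 2 (-1)) • shifted f 2 with hy
  set z := y + (-y (-2) / shifted f 1 (-2)) • shifted f 1 with hz'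
  have hzz : z ⬝ᵥ A.mulVec z = x ⬝ᵥ A.mulVec x := by rw [hz', hinv, hy, hinv]
  rw [← hzz]
  refine hA.quadForm_nonneg hf 0 ?_ ?_
  · rw [zero_sub, hz', hy]
    simp only [Pi.add_apply, Pi.smul_apply, smul_eq_mul, hz, mul_zero, add_zero]
    field_simp
    ring
  · rw [zero_sub, hz']
    simp only [Pi.add_apply, Pi.smul_apply, smul_eq_mul]
    field_simp
    ring

end Cyclic

/-! ### The shift operator on the cycle and polynomials in it -/

section Shift

variable {n : ℕ} {K : Type*} [Field K]

/-- The shift operator `φ ↦ φ (· + c)`. -/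
def shiftEnd (K : Type*) [Field K] (c : ZMod n) : Module.End K (ZMod n → K) :=
  LinearMap.funLeft K K fun i => i + c

@[simp] theorem shiftEnd_apply (c : ZMod n) (φ : ZMod n → K) (i : ZMod n) :
    shiftEnd K c φ i = φ (i + c) := rfl

theorem shiftEnd_pow_apply (c : ZMod n) (k : ℕ) (φ : ZMod n → K) (i : ZMod n) :
    (shiftEnd K c ^ k) φ i = φ (i + k * c) := by
  induction k generalizing i with
  | zero => simp
  | succ k ih =>
    rw [pow_succ', Module.End.mul_apply, shiftEnd_apply, ih]
    congr 1
    push_cast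
    ring

theorem aeval_shiftEnd_X_pow_sub_one (c : ZMod n) : aeval (shiftEnd K c) (X ^ n - 1 : K[X]) = 0 := by
  ext φ i
  simp [shiftEnd_pow_apply]

theorem sum_range_eq_sum_zmod [NeZero n] {M : Type*} [AddCommMonoid M] (g : ℕ → M) :
    ∑ k ∈ Finset.range n, g k = ∑ d : ZMod n, g d.val := by
  obtain ⟨k, rfl⟩ := Nat.exists_eq_succ_of_ne_zero (NeZero.ne n)
  exact (Fin.sum_univ_eq_sum_range g (k + 1)).symm

theorem aeval_shiftEnd_apply [NeZero n] {p : K[X]} (hp : p.natDegree < n) (c : ZMod n)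
    (φ : ZMod n → K) (i : ZMod n) :
    aeval (shiftEnd K c) p φ i = ∑ d : ZMod n, p.coeff d.val * φ (i + d * c) := by
  rw [aeval_eq_sum_range' hp, LinearMap.sum_apply, Finset.sum_apply, sum_range_eq_sum_zmod]
  refine Finset.sum_congr rfl fun d _ => ?_
  rw [LinearMap.smul_apply, Pi.smul_apply, shiftEnd_pow_apply, ZMod.natCast_zmod_val, smul_eq_mul]

end Shift

/-! ### Real quadratic factors with unimodular roots -/

section Quadratic

/-- The monic real polynomial with roots `exp (± i θ)`. -/
noncomputable def quadFactor (θ : ℝ) : ℝ[X] := X ^ 2 - C (2 * Real.cos θ) * X + 1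

theorem map_quadFactor (θ : ℝ) : (quadFactor θ).map (algebraMap ℝ ℂ) =
    (X - C (Complex.exp (θ * Complex.I))) * (X - C (Complex.exp (-θ * Complex.I))) := by
  have h1 : Complex.exp (θ * Complex.I) + Complex.exp (-θ * Complex.I) = 2 * Complex.cos θ := by
    rw [Complex.two_cos]
  have h2 : Complex.exp (θ * Complex.I) * Complex.exp (-θ * Complex.I) = 1 := by
    rw [← Complex.exp_add]; simp
  have hc : (C (Complex.exp (θ * Complex.I)) + C (Complex.exp (-θ * Complex.I)) : ℂ[X]) =
      C (2 * Complex.cos θ) := by rw [← C_add, h1]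
  have hm : (C (Complex.exp (θ * Complex.I)) * C (Complex.exp (-θ * Complex.I)) : ℂ[X]) = 1 := by
    rw [← C_mul, h2, C_1]
  have h3 : (quadFactor θ).map (algebraMap ℝ ℂ) = X ^ 2 - C (2 * Complex.cos θ) * X + 1 := by
    simp [quadFactor, Complex.ofReal_cos]
  rw [h3, ← hc]
  linear_combination (-1 : ℂ[X]) * hm

theorem aeval_quadFactor_self (θ : ℝ) : aeval (Complex.exp (θ * Complex.I)) (quadFactor θ) = 0 := by
  rw [aeval_def, ← eval_map, map_quadFactor]
  simp

theorem quadFactor_monic (θ : ℝ) : (quadFactor θ).Monic := by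
  unfold quadFactor; monicity!

theorem natDegree_quadFactor (θ : ℝ) : (quadFactor θ).natDegree = 2 := by
  unfold quadFactor; compute_degree!

theorem exp_pow_ne_one {n : ℕ} {θ : ℝ} (h : Real.sin (n * θ / 2) ≠ 0) :
    Complex.exp (θ * Complex.I) ^ n ≠ 1 := by
  rw [← Complex.exp_nat_mul]
  intro h1
  obtain ⟨k, hk⟩ := Complex.exp_eq_one_iff.1 h1
  apply h
  have h2 : (n * θ : ℂ) = k * (2 * Real.pi) := by
    have : (n * θ : ℂ) * Complex.I = k * (2 * Real.pi) * Complex.I := by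
      linear_combination hk
    exact mul_right_cancel₀ Complex.I_ne_zero this
  have h3 : (n * θ : ℝ) = k * (2 * Real.pi) := by exact_mod_cast h2
  rw [show (n * θ / 2 : ℝ) = k * Real.pi by linarith]
  exact Real.sin_int_mul_pi k

/-- Over ℂ the roots are exp(±iθ), and sin(nθ/2) ≠ 0 prevents them from being n-th roots of unity.
-/
theorem isCoprime_quadFactor {n : ℕ} {θ : ℝ} (h : Real.sin (n * θ / 2) ≠ 0) :
    IsCoprime (quadFactor θ) (X ^ n - 1) := by
  rw [← isCoprime_map (algebraMap ℝ ℂ), map_quadFactor]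
  have key : ∀ ω : ℂ, ω ^ n ≠ 1 → IsCoprime (X - C ω) ((X ^ n - 1 : ℝ[X]).map (algebraMap ℝ ℂ)) := by
    intro ω hω
    rw [(irreducible_X_sub_C ω).coprime_iff_not_dvd, dvd_iff_isRoot]
    simpa [sub_eq_zero] using hω
  refine IsCoprime.mul_left (key _ (exp_pow_ne_one h)) (key _ ?_)
  have := exp_pow_ne_one (n := n) (θ := -θ) (by
    rw [show (n * -θ / 2 : ℝ) = -(n * θ / 2) by ring, Real.sin_neg]; exact neg_ne_zero.2 h)
  simpa using this

end Quadratic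

/-! ### Chebyshev polynomials and Lagrange interpolation -/

section Trig

variable {m : ℕ}

theorem injective_cos_comp {ζ : Fin m → ℝ} (hinj : Function.Injective ζ)
    (hζ : ∀ j, ζ j ∈ Set.Ioo 0 Real.pi) : Function.Injective fun j => Real.cos (ζ j) :=
  fun i j h => hinj (Real.injOn_cos ⟨(hζ i).1.le, (hζ i).2.le⟩ ⟨(hζ j).1.le, (hζ j).2.le⟩ h)

/-- sin((l + 1)ζ)/sin ζ equals U_l(cos ζ), so the sum is Lagrange's formula for the coefficient of
degree m − 1 of U_l at the nodes cos ζ_j. -/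
theorem sum_sin_div_prod_eq_coeff {ζ : Fin m → ℝ} (hinj : Function.Injective ζ)
    (hζ : ∀ j, ζ j ∈ Set.Ioo 0 Real.pi) {l : ℕ} (hl : l < m) :
    ∑ j, Real.sin ((l + 1 : ℝ) * ζ j) /
      (Real.sin (ζ j) * ∏ i ∈ Finset.univ.erase j, (Real.cos (ζ j) - Real.cos (ζ i))) =
    (Chebyshev.U ℝ l).coeff (m - 1) := by
  have h := Lagrange.coeff_eq_sum (s := Finset.univ) (v := fun j => Real.cos (ζ j))
    (injective_cos_comp hinj hζ).injOn (P := Chebyshev.U ℝ l) (by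
      rw [Chebyshev.degree_U_natCast]; simpa using hl)
  rw [Finset.card_univ, Fintype.card_fin] at h
  rw [h]
  refine Finset.sum_congr rfl fun j _ => ?_
  have hs := (Real.sin_pos_of_mem_Ioo (hζ j)).ne'
  have hU := Chebyshev.U_real_cos (ζ j) l
  push_cast at hU
  rw [← hU, mul_comm (Real.sin (ζ j)), mul_div_mul_right _ _ hs]

/-- The sum is odd and vanishes below the number of nodes. -/
theorem sum_sin_div_prod_eq_zero {ζ : Fin m → ℝ} (hinj : Function.Injective ζ)
    (hζ : ∀ j, ζ j ∈ Set.Ioo 0 Real.pi) {l : ℤ} (hl : |l| < m) :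
    ∑ j, Real.sin (l * ζ j) /
      (Real.sin (ζ j) * ∏ i ∈ Finset.univ.erase j, (Real.cos (ζ j) - Real.cos (ζ i))) = 0 := by
  have key : ∀ k : ℕ, k < m → ∑ j, Real.sin (k * ζ j) /
      (Real.sin (ζ j) * ∏ i ∈ Finset.univ.erase j, (Real.cos (ζ j) - Real.cos (ζ i))) = 0 := by
    intro k hk
    rcases k with _ | k
    · simp
    · push_cast
      rw [sum_sin_div_prod_eq_coeff hinj hζ (by omega)]
      refine coeff_eq_zero_of_natDegree_lt ?_
      rw [Chebyshev.natDegree_U_natCast]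
      omega
  obtain ⟨k, rfl | rfl⟩ := Int.eq_nat_or_neg l
  · simpa using key k (by simpa using hl)
  · have := key k (by simpa using hl)
    simp only [Int.cast_neg, Int.cast_natCast, neg_mul, Real.sin_neg, neg_div,
      Finset.sum_neg_distrib, this, neg_zero]

/-- First nonvanishing case: U_(m−1) has degree m − 1, and the coefficient is its leading one. -/
theorem sum_sin_div_prod_eq_pow {ζ : Fin m → ℝ} (hinj : Function.Injective ζ)
    (hζ : ∀ j, ζ j ∈ Set.Ioo 0 Real.pi) (hm : 0 < m) :
    ∑ j, Real.sin (m * ζ j) /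
      (Real.sin (ζ j) * ∏ i ∈ Finset.univ.erase j, (Real.cos (ζ j) - Real.cos (ζ i))) =
      2 ^ (m - 1) := by
  obtain ⟨k, rfl⟩ := Nat.exists_eq_succ_of_ne_zero hm.ne'
  have := sum_sin_div_prod_eq_coeff hinj hζ (Nat.lt_succ_self k)
  push_cast
  rw [this, Nat.succ_sub_one, ← Chebyshev.leadingCoeff_U_natCast ℝ k, leadingCoeff,
    Chebyshev.natDegree_U_natCast]

theorem cos_sub_cos_reflect (a b θ : ℝ) :
    Real.cos (a * θ) - Real.cos ((b - a) * θ) = 2 * Real.sin (b * θ / 2) * Real.sin ((b / 2 - a) * θ) := by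
  rw [Real.cos_sub_cos, show (a * θ + (b - a) * θ) / 2 = b * θ / 2 by ring,
    show (a * θ - (b - a) * θ) / 2 = -((b / 2 - a) * θ) by ring, Real.sin_neg]
  ring

end Trig

/-! ### Circulant matrices folded from Toeplitz sequences -/

section Fold

variable {n : ℕ}

/-- The symmetric circulant matrix whose first row is `b`, folded into the cycle. -/
noncomputable def circMat (n : ℕ) (b : ℤ → ℝ) : Matrix (ZMod n) (ZMod n) ℝ :=
  Matrix.of fun i j => b (j - i).valMinAbs

/-- Even sequences that are invariant, apart from few terms, under the reflection of the cycle. -/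
structure IsFoldable (n : ℕ) (b : ℤ → ℝ) : Prop where
  even : ∀ k, b (-k) = b k
  refl : ∀ k : ℤ, 2 < k → k < n - 2 → b (n - k) = b k

theorem IsFoldable.abs {b : ℤ → ℝ} (hb : IsFoldable n b) (k : ℤ) : b |k| = b k := by
  rcases abs_choice k with h | h <;> rw [h]
  exact hb.even k

theorem circMat_add (b : ℤ → ℝ) (i j k : ZMod n) : circMat n b (i + k) (j + k) = circMat n b i j := by
  simp only [circMat, Matrix.of_apply]
  congr 2
  ring

theorem natCast_val_neg_two (hn : 5 < n) : ((-2 : ZMod n).val : ℤ) = n - 2 := by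
  have h : (-2 : ZMod n) = ((n - 2 : ℕ) : ZMod n) := by
    rw [Nat.cast_sub (by omega), ZMod.natCast_self]; simp
  rw [h, ZMod.val_natCast, Nat.mod_eq_of_lt (by omega)]
  omega

theorem natCast_val_neg_one (hn : 5 < n) : ((-1 : ZMod n).val : ℤ) = n - 1 := by
  have h : (-1 : ZMod n) = ((n - 1 : ℕ) : ZMod n) := by
    rw [Nat.cast_sub (by omega), ZMod.natCast_self]; simp
  rw [h, ZMod.val_natCast, Nat.mod_eq_of_lt (by omega)]
  omega

variable [NeZero n]

theorem val_add_three_le {d : ZMod n} (h1 : d ≠ -1) (h2 : d ≠ -2) : d.val + 3 ≤ n := by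
  have h := ZMod.val_lt d
  have hd := ZMod.natCast_zmod_val d
  by_contra hlt
  have h3 : d.val + 1 = n ∨ d.val + 2 = n := by omega
  rcases h3 with h3 | h3
  · apply h1
    have hn0 : ((d.val + 1 : ℕ) : ZMod n) = 0 := by rw [h3, ZMod.natCast_self]
    push_cast at hn0
    rw [hd] at hn0
    linear_combination hn0
  · apply h2
    have hn0 : ((d.val + 2 : ℕ) : ZMod n) = 0 := by rw [h3, ZMod.natCast_self]
    push_cast at hn0
    rw [hd] at hn0
    linear_combination hn0

variable {b : ℤ → ℝ}

theorem IsFoldable.valMinAbs_neg (hb : IsFoldable n b) (i : ZMod n) :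
    b (-i).valMinAbs = b i.valMinAbs := by
  by_cases h : 2 * i.val = n
  · have : -i = i := by
      have h0 : ((2 * i.val : ℕ) : ZMod n) = 0 := by rw [h, ZMod.natCast_self]
      push_cast at h0
      rw [ZMod.natCast_zmod_val] at h0
      linear_combination -h0
    rw [this]
  · rw [ZMod.valMinAbs_neg_of_ne_half h, hb.even]

theorem circMat_isSymm (hb : IsFoldable n b) : (circMat n b).IsSymm := by
  ext i j
  simp only [circMat, Matrix.transpose_apply, Matrix.of_apply]
  rw [← neg_sub, hb.valMinAbs_neg]

theorem valMinAbs_intCast_of_le {k : ℤ} (h1 : -(n : ℤ) < k * 2) (h2 : k * 2 ≤ n) :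
    (k : ZMod n).valMinAbs = k := (ZMod.valMinAbs_spec _ _).2 ⟨rfl, h1, h2⟩

theorem valMinAbs_intCast_of_gt {k : ℤ} (h1 : (n : ℤ) < k * 2) (h2 : k < n) :
    (k : ZMod n).valMinAbs = k - n := (ZMod.valMinAbs_spec _ _).2
  ⟨by push_cast; simp, by omega, by omega⟩

theorem IsFoldable.fold_natAbs (hb : IsFoldable n b) (k : ℤ) :
    b (k : ZMod n).valMinAbs = b ((|k| : ℤ) : ZMod n).valMinAbs := by
  rcases abs_choice k with h | h <;> rw [h]
  rw [Int.cast_neg, hb.valMinAbs_neg]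

/-- The differences |k| ≤ n − 3 are those within a window, so there the circulant looks like the
Toeplitz matrix of b. Beyond n/2 the folding replaces k by n − k up to sign, which `refl` makes
invisible. -/
theorem IsFoldable.fold_eq (hn : 5 < n) (hb : IsFoldable n b) {k : ℤ} (hk : |k| + 3 ≤ n) :
    b (k : ZMod n).valMinAbs = b k := by
  rw [hb.fold_natAbs, ← hb.abs k]
  have h0 := abs_nonneg k
  generalize |k| = l at *
  by_cases h : l * 2 ≤ n
  · rw [valMinAbs_intCast_of_le (by omega) h]
  · rw [valMinAbs_intCast_of_gt (by omega) (by omega), ← hb.even, neg_sub, hb.refl l (by omega)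
      (by omega)]

/-- At distance n − 2 the folding becomes visible: the entry is b 2 instead of b (n − 2). This gap
determines the products with the zeros and makes copositivity work. -/
theorem IsFoldable.fold_eq_two (hn : 5 < n) (hb : IsFoldable n b) {k : ℤ} (hk : |k| + 2 = n) :
    b (k : ZMod n).valMinAbs = b 2 := by
  rw [hb.fold_natAbs, valMinAbs_intCast_of_gt (by omega) (by omega),
    show |k| - n = -2 by omega, hb.even]

theorem circMat_mulVec_shifted_apply (f : ZMod n → ℝ) (i j : ZMod n) :
    (circMat n b).mulVec (shifted f j) i = (circMat n b).mulVec f (i - j) := by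
  simp only [Matrix.mulVec, dotProduct, shifted]
  rw [← Equiv.sum_comp (Equiv.addRight j)]
  refine Finset.sum_congr rfl fun d _ => ?_
  simp only [Equiv.coe_addRight, add_sub_cancel_right]
  rw [← circMat_add b (i - j) d j, sub_add_cancel]

variable {f : ZMod n → ℝ}

theorem circMat_mulVec (f : ZMod n → ℝ) (k : ℤ) : (circMat n b).mulVec f k =
    ∑ d, f d * b ((d.val - k : ℤ) : ZMod n).valMinAbs := by
  simp only [Matrix.mulVec, dotProduct]
  refine Finset.sum_congr rfl fun d _ => ?_
  rw [mul_comm, circMat, Matrix.of_apply]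
  push_cast
  rw [ZMod.natCast_zmod_val]

theorem circMat_mulVec_eq_zero (hn : 5 < n) (hb : IsFoldable n b) (hf : IsZeroProfile f)
    (hrec : ∀ s : ℤ, ∑ d : ZMod n, f d * b (d.val + s) = 0) {i : ZMod n} (h1 : i ≠ -1)
    (h2 : i ≠ -2) : (circMat n b).mulVec f i = 0 := by
  have hi : ((i.val : ℤ) : ZMod n) = i := by push_cast; exact ZMod.natCast_zmod_val i
  rw [← hi, circMat_mulVec, ← hrec (-i.val)]
  refine Finset.sum_congr rfl fun d _ => ?_
  by_cases hd1 : d = -1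
  · rw [hd1, hf.neg_one, zero_mul, zero_mul]
  by_cases hd2 : d = -2
  · rw [hd2, hf.neg_two, zero_mul, zero_mul]
  rw [hb.fold_eq hn, sub_eq_add_neg]
  have := val_add_three_le h1 h2
  have := val_add_three_le hd1 hd2
  rw [← le_sub_iff_add_le, abs_le]
  constructor <;> omega

/-- Subtract the recurrence at the same offset. Only one end of the window of f, namely d = 0, is at
distance n − 2 from this position; for the position −1 it is the other end, d = −3. -/
theorem circMat_mulVec_neg_two (hn : 5 < n) (hb : IsFoldable n b) (hf : IsZeroProfile f)
    (hrec : ∀ s : ℤ, ∑ d : ZMod n, f d * b (d.val + s) = 0) :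
    (circMat n b).mulVec f (-2) = f 0 * (b 2 - b (n - 2)) := by
  have hi : (((n - 2 : ℤ)) : ZMod n) = -2 := by push_cast; simp
  rw [← hi, circMat_mulVec, ← sub_zero (Finset.sum _ _), ← hrec (-(n - 2)), ← Finset.sum_sub_distrib,
    Finset.sum_eq_single (0 : ZMod n)]
  · rw [ZMod.val_zero, Nat.cast_zero, zero_sub, zero_add, hb.fold_eq_two hn, hb.even, mul_sub]
    rw [abs_neg, abs_of_nonneg] <;> omega
  · intro d _ hd0
    by_cases hd1 : d = -1
    · rw [hd1, hf.neg_one, zero_mul, zero_mul, sub_zero]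
    by_cases hd2 : d = -2
    · rw [hd2, hf.neg_two, zero_mul, zero_mul, sub_zero]
    rw [hb.fold_eq hn, ← sub_eq_add_neg (d.val : ℤ), sub_self]
    have := val_add_three_le hd1 hd2
    have : d.val ≠ 0 := fun h => hd0 ((ZMod.val_eq_zero d).1 h)
    rw [← le_sub_iff_add_le, abs_le]
    constructor <;> omega
  · simp

theorem circMat_mulVec_neg_one (hn : 5 < n) (hb : IsFoldable n b) (hf : IsZeroProfile f)
    (hrec : ∀ s : ℤ, ∑ d : ZMod n, f d * b (d.val + s) = 0) :
    (circMat n b).mulVec f (-1) = f 0 * (b 2 - b (n - 2)) := by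
  have hi : ((-1 : ℤ) : ZMod n) = -1 := by push_cast; simp
  have h3 : (-3 : ZMod n) = ((n - 3 : ℕ) : ZMod n) := by
    rw [Nat.cast_sub (by omega), ZMod.natCast_self]; simp
  have h3v : (-3 : ZMod n).val = n - 3 := by
    rw [h3, ZMod.val_natCast, Nat.mod_eq_of_lt (by omega)]
  rw [← hi, circMat_mulVec, ← sub_zero (Finset.sum _ _), ← hrec (- -1), ← Finset.sum_sub_distrib,
    Finset.sum_eq_single (-3 : ZMod n)]
  · rw [h3v, ← sub_eq_add_neg, hb.fold_eq_two hn,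
      show (((n - 3 : ℕ) : ℤ) - -1) = n - 2 by omega, ← hf.symm 0, sub_zero, mul_sub]
    rw [abs_of_nonneg] <;> omega
  · intro d _ hd0
    by_cases hd1 : d = -1
    · rw [hd1, hf.neg_one, zero_mul, zero_mul, sub_zero]
    by_cases hd2 : d = -2
    · rw [hd2, hf.neg_two, zero_mul, zero_mul, sub_zero]
    rw [hb.fold_eq hn, ← sub_eq_add_neg (d.val : ℤ), sub_self]
    have := val_add_three_le hd1 hd2
    have : d.val ≠ n - 3 := fun h => hd0 (by
      rw [h3, ← h, ZMod.natCast_zmod_val])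
    rw [← le_sub_iff_add_le, abs_le]
    constructor <;> omega
  · simp

theorem dotProduct_circMat_mulVec_shifted (hn : 5 < n) (hb : IsFoldable n b) (hf : IsZeroProfile f)
    (hrec : ∀ s : ℤ, ∑ d : ZMod n, f d * b (d.val + s) = 0) (x : ZMod n → ℝ) (j : ZMod n) :
    x ⬝ᵥ (circMat n b).mulVec (shifted f j) =
      f 0 * (b 2 - b (n - 2)) * (x (j - 2) + x (j - 1)) := by
  rw [dotProduct_eq_two_terms hn (j := j), circMat_mulVec_shifted_apply,
    circMat_mulVec_shifted_apply, show (j - 2 - j : ZMod n) = -2 by ring,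
    show (j - 1 - j : ZMod n) = -1 by ring, circMat_mulVec_neg_one hn hb hf hrec,
    circMat_mulVec_neg_two hn hb hf hrec]
  · ring
  · intro i h1 h2
    rw [circMat_mulVec_shifted_apply]
    exact circMat_mulVec_eq_zero hn hb hf hrec (fun h => h1 (by linear_combination h))
      (fun h => h2 (by linear_combination h))

theorem quadForm_circMat_eq (hn : 5 < n) (hb : IsFoldable n b) {x : ZMod n → ℝ}
    (h1 : x (-1) = 0) (h2 : x (-2) = 0) : x ⬝ᵥ (circMat n b).mulVec x =
      ∑ i, ∑ d, x i * x d * b (d.val - i.val) := by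
  rw [dotProduct]
  refine Finset.sum_congr rfl fun i _ => ?_
  have hi : ((i.val : ℤ) : ZMod n) = i := by push_cast; exact ZMod.natCast_zmod_val i
  by_cases hi1 : i = -1
  · simp [hi1, h1]
  by_cases hi2 : i = -2
  · simp [hi2, h2]
  conv_lhs => rw [← hi, circMat_mulVec, hi, Finset.mul_sum]
  refine Finset.sum_congr rfl fun d _ => ?_
  by_cases hd1 : d = -1
  · simp [hd1, h1]
  by_cases hd2 : d = -2
  · simp [hd2, h2]
  rw [hb.fold_eq hn, mul_assoc]
  have := val_add_three_le hi1 hi2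
  have := val_add_three_le hd1 hd2
  rw [← le_sub_iff_add_le, abs_le]
  constructor <;> omega

/-- With a single zero entry, distances up to n − 2 occur. At distance n − 2 the folded entry b 2 is
at least b (n − 2), and x ≥ 0 turns this into an inequality of forms. -/
theorem le_quadForm_circMat (hn : 5 < n) (hb : IsFoldable n b) (hb2 : b (n - 2) ≤ b 2)
    {x : ZMod n → ℝ} (hx : ∀ i, 0 ≤ x i) (h1 : x (-1) = 0) :
    ∑ i, ∑ d, x i * x d * b (d.val - i.val) ≤ x ⬝ᵥ (circMat n b).mulVec x := by
  rw [dotProduct]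
  refine Finset.sum_le_sum fun i _ => ?_
  have hi : ((i.val : ℤ) : ZMod n) = i := by push_cast; exact ZMod.natCast_zmod_val i
  by_cases hi1 : i = -1
  · simp [hi1, h1]
  conv_rhs => rw [← hi, circMat_mulVec, hi, Finset.mul_sum]
  refine Finset.sum_le_sum fun d _ => ?_
  by_cases hd1 : d = -1
  · simp [hd1, h1]
  rw [mul_assoc]
  refine mul_le_mul_of_nonneg_left (mul_le_mul_of_nonneg_left ?_ (hx d)) (hx i)
  have hlt : ∀ {d : ZMod n}, d ≠ -1 → d.val + 2 ≤ n := by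
    intro d hd
    by_cases hd2 : d = -2
    · have := natCast_val_neg_two hn
      rw [hd2]; omega
    · have := val_add_three_le hd hd2
      omega
  have hi' := hlt hi1
  have hd' := hlt hd1
  rcases lt_or_ge (|(d.val : ℤ) - i.val| + 2) n with h | h
  · rw [hb.fold_eq hn (by omega)]
  · have : |(d.val : ℤ) - i.val| + 2 = n := by
      refine le_antisymm ?_ h
      rw [← le_sub_iff_add_le, abs_le]
      constructor <;> omega
    rw [hb.fold_eq_two hn this, ← hb.abs, show |(d.val : ℤ) - i.val| = n - 2 by omega]
    exact hb2

end Fold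

/-! ### Toeplitz forms of cosine sums -/

section TrigSeq

variable {n m : ℕ} [NeZero n]

/-- The weighted sum of cosines with given frequencies. -/
noncomputable def trigSeq (w ζ : Fin m → ℝ) (k : ℤ) : ℝ := ∑ j, w j * Real.cos (k * ζ j)

/-- The double sum is |∑ x_d exp(idθ)|², split into real and imaginary parts. -/
theorem sum_mul_cos_sub (x : ZMod n → ℝ) (θ : ℝ) :
    ∑ i, ∑ d, x i * x d * Real.cos (((d.val - i.val : ℤ) : ℝ) * θ) =
      (∑ d, x d * Real.cos (d.val * θ)) ^ 2 + (∑ d, x d * Real.sin (d.val * θ)) ^ 2 := by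
  rw [sq, sq, Finset.sum_mul_sum, Finset.sum_mul_sum, ← Finset.sum_add_distrib]
  refine Finset.sum_congr rfl fun i _ => ?_
  rw [← Finset.sum_add_distrib]
  refine Finset.sum_congr rfl fun d _ => ?_
  push_cast
  rw [sub_mul, Real.cos_sub]
  ring

theorem sum_mul_trigSeq (w ζ : Fin m → ℝ) (x : ZMod n → ℝ) :
    ∑ i, ∑ d, x i * x d * trigSeq w ζ (d.val - i.val) =
      ∑ j, w j * ((∑ d, x d * Real.cos (d.val * ζ j)) ^ 2 +
        (∑ d, x d * Real.sin (d.val * ζ j)) ^ 2) := by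
  simp only [← sum_mul_cos_sub, trigSeq, Finset.mul_sum]
  conv_rhs => rw [Finset.sum_comm]
  refine Finset.sum_congr rfl fun i _ => ?_
  conv_rhs => rw [Finset.sum_comm]
  refine Finset.sum_congr rfl fun d _ => ?_
  exact Finset.sum_congr rfl fun j _ => by ring

theorem aeval_exp_eq {p : ℝ[X]} (hp : p.natDegree < n) (θ : ℝ) :
    aeval (Complex.exp (θ * Complex.I)) p =
      ((∑ d : ZMod n, p.coeff d.val * Real.cos (d.val * θ) : ℝ) : ℂ) +
        ((∑ d : ZMod n, p.coeff d.val * Real.sin (d.val * θ) : ℝ) : ℂ) * Complex.I := by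
  rw [aeval_eq_sum_range' hp, sum_range_eq_sum_zmod]
  push_cast
  rw [Finset.sum_mul, ← Finset.sum_add_distrib]
  refine Finset.sum_congr rfl fun d _ => ?_
  rw [← Complex.exp_nat_mul, ← mul_assoc, Complex.exp_mul_I, Complex.real_smul]
  ring

/-- Each translate of k ↦ cos(kζ_j) is a combination of cos(kζ_j) and sin(kζ_j), the real and
imaginary parts of the powers of a root of p. -/
theorem sum_coeff_mul_trigSeq {p : ℝ[X]} (hp : p.natDegree < n) (w ζ : Fin m → ℝ)
    (h0 : ∀ j, aeval (Complex.exp (ζ j * Complex.I)) p = 0) (s : ℤ) :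
    ∑ d : ZMod n, p.coeff d.val * trigSeq w ζ (d.val + s) = 0 := by
  simp only [trigSeq, Finset.mul_sum]
  rw [Finset.sum_comm]
  refine Finset.sum_eq_zero fun j _ => ?_
  have h := h0 j
  rw [aeval_exp_eq hp] at h
  have hre := congrArg Complex.re h
  have him := congrArg Complex.im h
  simp only [Complex.add_re, Complex.add_im, Complex.ofReal_re, Complex.ofReal_im, Complex.mul_re,
    Complex.mul_im, Complex.I_re, Complex.I_im, Complex.zero_re, Complex.zero_im, mul_zero, mul_one,
    sub_zero, add_zero, zero_add] at hre him
  calc ∑ d : ZMod n, p.coeff d.val * (w j * Real.cos (((d.val + s : ℤ) : ℝ) * ζ j))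
      = w j * (Real.cos (s * ζ j) * ∑ d : ZMod n, p.coeff d.val * Real.cos (d.val * ζ j) -
        Real.sin (s * ζ j) * ∑ d : ZMod n, p.coeff d.val * Real.sin (d.val * ζ j)) := by
        rw [Finset.mul_sum, Finset.mul_sum, ← Finset.sum_sub_distrib, Finset.mul_sum]
        refine Finset.sum_congr rfl fun d _ => ?_
        push_cast
        rw [add_mul, Real.cos_add]
        ring
    _ = 0 := by rw [hre, him]; ring

theorem trigSeq_window_eq {p : ℝ[X]} (hp : p.natDegree < n) (w ζ : Fin m → ℝ) :
    ∑ i : ZMod n, ∑ d : ZMod n, p.coeff i.val * p.coeff d.val * trigSeq w ζ (d.val - i.val) =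
      ∑ j, w j * Complex.normSq (aeval (Complex.exp (ζ j * Complex.I)) p) := by
  rw [sum_mul_trigSeq w ζ fun d : ZMod n => p.coeff d.val]
  refine Finset.sum_congr rfl fun j _ => ?_
  rw [aeval_exp_eq hp, Complex.normSq_add_mul_I]

end TrigSeq

/-! ### The weights of the extremal matrix -/

section FundWeight

variable {n m : ℕ}

/-- The weights in the explicit formula for the extremal matrix. -/
noncomputable def fundWeight (n : ℕ) (ζ : Fin m → ℝ) (j : Fin m) : ℝ :=
  (Real.sin (ζ j) * Real.sin (n * ζ j / 2) *
      ∏ l ∈ Finset.univ.erase j, (Real.cos (ζ j) - Real.cos (ζ l)))⁻¹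

/-- Reflecting k to n − k produces a factor sin(nζ_j/2), which cancels the same factor in the
weight. -/
theorem trigSeq_fundWeight_sub (ζ : Fin m → ℝ)
    (hsin : ∀ j, Real.sin (n * ζ j / 2) ≠ 0) (k : ℤ) :
    trigSeq (fundWeight n ζ) ζ k - trigSeq (fundWeight n ζ) ζ (n - k) =
      2 * ∑ j, Real.sin ((n / 2 - k : ℝ) * ζ j) /
      (Real.sin (ζ j) * ∏ i ∈ Finset.univ.erase j, (Real.cos (ζ j) - Real.cos (ζ i))) := by
  rw [trigSeq, trigSeq, ← Finset.sum_sub_distrib, Finset.mul_sum]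
  refine Finset.sum_congr rfl fun j _ => ?_
  push_cast
  rw [← mul_sub, cos_sub_cos_reflect, fundWeight]
  have h := hsin j
  calc (Real.sin (ζ j) * Real.sin (n * ζ j / 2) *
        ∏ l ∈ Finset.univ.erase j, (Real.cos (ζ j) - Real.cos (ζ l)))⁻¹ *
        (2 * Real.sin (n * ζ j / 2) * Real.sin ((n / 2 - k) * ζ j))
      = (Real.sin (n * ζ j / 2) * (Real.sin (n * ζ j / 2))⁻¹) *
        (2 * (Real.sin ((n / 2 - k) * ζ j) * ((Real.sin (ζ j))⁻¹ *
          (∏ l ∈ Finset.univ.erase j, (Real.cos (ζ j) - Real.cos (ζ l)))⁻¹))) := by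
        rw [mul_inv, mul_inv]; ring
    _ = _ := by rw [mul_inv_cancel₀ h, one_mul, ← mul_inv, ← div_eq_mul_inv]

/-- Since n/2 = m + 2, the range 2 < k < n − 2 is |n/2 − k| < m, where the interpolation sums
vanish. At k = 2 the frequency is exactly m, and the sum is positive. -/
theorem trigSeq_fundWeight_foldable (hnm : n = 2 * m + 4) {ζ : Fin m → ℝ}
    (hinj : Function.Injective ζ) (hζ : ∀ j, ζ j ∈ Set.Ioo 0 Real.pi)
    (hsin : ∀ j, Real.sin (n * ζ j / 2) ≠ 0) : IsFoldable n (trigSeq (fundWeight n ζ) ζ) where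
  even k := by simp [trigSeq]
  refl k h1 h2 := by
    refine (sub_eq_zero.1 ?_).symm
    rw [trigSeq_fundWeight_sub ζ hsin]
    have := sum_sin_div_prod_eq_zero hinj hζ (l := m + 2 - k) (by rw [abs_lt]; omega)
    have hc : (n / 2 - k : ℝ) = ((m + 2 - k : ℤ) : ℝ) := by rw [hnm]; push_cast; ring
    rw [hc, this, mul_zero]

theorem trigSeq_fundWeight_gap (hnm : n = 2 * m + 4) (hm : 0 < m) {ζ : Fin m → ℝ}
    (hinj : Function.Injective ζ) (hζ : ∀ j, ζ j ∈ Set.Ioo 0 Real.pi)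
    (hsin : ∀ j, Real.sin (n * ζ j / 2) ≠ 0) :
    0 < trigSeq (fundWeight n ζ) ζ 2 - trigSeq (fundWeight n ζ) ζ (n - 2) := by
  rw [trigSeq_fundWeight_sub ζ hsin]
  have hc : (n / 2 - (2 : ℤ) : ℝ) = m := by rw [hnm]; push_cast; ring
  rw [hc, sum_sin_div_prod_eq_pow hinj hζ hm]
  positivity

end FundWeight

/-! ### The face for a factored polynomial: decomposition, signs, copositivity -/

section Factored

variable {n m : ℕ}

/-- The matrix of signs `(-1) ^ (i - j)` on the cycle. -/
def altMat (n : ℕ) : Matrix (ZMod n) (ZMod n) ℝ := Matrix.of fun i j => altSign i * altSign j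

theorem altMat_isSymm : (altMat n).IsSymm := by
  ext i j
  simp [altMat, mul_comm]

/-- A profile whose polynomial splits into `X + 1` and quadratic factors with distinct unimodular
roots, none of which is an `n`-th root of unity. -/
structure IsFactored (p : ℝ[X]) (ζ : Fin m → ℝ) (f : ZMod n → ℝ) : Prop where
  size : n = 2 * m + 4
  m_pos : 0 < m
  inj : Function.Injective ζ
  mem : ∀ j, ζ j ∈ Set.Ioo 0 Real.pi
  sin_ne : ∀ j, Real.sin (n * ζ j / 2) ≠ 0
  coeff : ∀ d, f d = p.coeff d.val
  factor : ∃ a : ℝ, 0 < a ∧ p = C a * ((X + 1) * ∏ j, quadFactor (ζ j))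

theorem aeval_exp_quadFactor (θ η : ℝ) : aeval (Complex.exp (θ * Complex.I)) (quadFactor η) =
    Complex.exp (θ * Complex.I) * ((2 * (Real.cos θ - Real.cos η) : ℝ) : ℂ) := by
  have h := aeval_quadFactor_self θ
  simp only [quadFactor, map_add, map_sub, map_mul, map_pow, aeval_X, aeval_C, map_one,
    Complex.coe_algebraMap] at h ⊢
  push_cast at h ⊢
  linear_combination h

theorem exp_add_one_ne_zero {θ : ℝ} (hθ : θ ∈ Set.Ioo 0 Real.pi) :
    Complex.exp (θ * Complex.I) + 1 ≠ 0 := by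
  intro h
  have := congrArg Complex.im h
  rw [Complex.add_im, Complex.exp_ofReal_mul_I_im, Complex.one_im, add_zero, Complex.zero_im] at this
  exact (Real.sin_pos_of_mem_Ioo hθ).ne' this

variable {p : ℝ[X]} {ζ : Fin m → ℝ} {f : ZMod n → ℝ}

theorem natDegree_prod_quadFactor (s : Finset (Fin m)) :
    (∏ j ∈ s, quadFactor (ζ j)).natDegree = 2 * s.card := by
  rw [natDegree_prod_of_monic _ _ fun j _ => quadFactor_monic _]
  simp [natDegree_quadFactor, mul_comm]

theorem natDegree_X_add_one_mul_prod (s : Finset (Fin m)) :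
    ((X + 1) * ∏ j ∈ s, quadFactor (ζ j)).natDegree = 2 * s.card + 1 := by
  rw [← C_1, (monic_X_add_C (1 : ℝ)).natDegree_mul (monic_prod_of_monic _ _ fun j _ =>
    quadFactor_monic _), natDegree_X_add_C, natDegree_prod_quadFactor, add_comm]

theorem IsFactored.natDegree_lt (h : IsFactored p ζ f) : p.natDegree < n := by
  obtain ⟨a, ha, hp⟩ := h.factor
  rw [hp, natDegree_C_mul ha.ne', natDegree_X_add_one_mul_prod, h.size]
  simp

theorem IsFactored.five_lt (h : IsFactored p ζ f) : 5 < n := by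
  have := h.size
  have := h.m_pos
  omega

theorem IsFactored.even (h : IsFactored p ζ f) : Even n := ⟨m + 2, by rw [h.size]; ring⟩

theorem IsFactored.aeval_eq_zero (h : IsFactored p ζ f) (j : Fin m) :
    aeval (Complex.exp (ζ j * Complex.I)) p = 0 := by
  obtain ⟨a, ha, hp⟩ := h.factor
  rw [hp, map_mul, map_mul, map_prod, Finset.prod_eq_zero (Finset.mem_univ j)
    (aeval_quadFactor_self (ζ j)), mul_zero, mul_zero]

/-- The explicit extremal matrix. -/
noncomputable def fundMat (n : ℕ) (ζ : Fin m → ℝ) : Matrix (ZMod n) (ZMod n) ℝ :=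
  circMat n (trigSeq (fundWeight n ζ) ζ)

theorem IsFactored.foldable (h : IsFactored p ζ f) : IsFoldable n (trigSeq (fundWeight n ζ) ζ) :=
  trigSeq_fundWeight_foldable h.size h.inj h.mem h.sin_ne

theorem IsFactored.gap (h : IsFactored p ζ f) :
    0 < trigSeq (fundWeight n ζ) ζ 2 - trigSeq (fundWeight n ζ) ζ (n - 2) :=
  trigSeq_fundWeight_gap h.size h.m_pos h.inj h.mem h.sin_ne

theorem IsFactored.fundMat_isSymm [NeZero n] (h : IsFactored p ζ f) : (fundMat n ζ).IsSymm :=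
  circMat_isSymm h.foldable

theorem coeff_val_eq_zero (hn : 5 < n) {g : ℝ[X]} (hg : g.natDegree + 2 < n) :
    g.coeff (-1 : ZMod n).val = 0 ∧ g.coeff (-2 : ZMod n).val = 0 := by
  have h1 := natCast_val_neg_one hn
  have h2 := natCast_val_neg_two hn
  exact ⟨coeff_eq_zero_of_natDegree_lt (by omega), coeff_eq_zero_of_natDegree_lt (by omega)⟩

variable [NeZero n]

theorem IsFactored.exists_gap (h : IsFactored p ζ f) (hf : IsZeroProfile f) :
    ∃ γ : ℝ, 0 < γ ∧ ∀ x j,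
      x ⬝ᵥ (fundMat n ζ).mulVec (shifted f j) = γ * (x (j - 2) + x (j - 1)) := by
  refine ⟨_, mul_pos (hf.zero_pos h.five_lt) h.gap,
    dotProduct_circMat_mulVec_shifted h.five_lt h.foldable hf fun s => ?_⟩
  simp only [h.coeff]
  exact sum_coeff_mul_trigSeq h.natDegree_lt _ _ h.aeval_eq_zero s

theorem altMat_mulVec (x : ZMod n → ℝ) (i : ZMod n) :
    (altMat n).mulVec x i = altSign i * ∑ d, altSign d * x d := by
  simp [Matrix.mulVec, dotProduct, altMat, Finset.mul_sum, mul_assoc]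

theorem quadForm_altMat (x : ZMod n → ℝ) :
    x ⬝ᵥ (altMat n).mulVec x = (∑ d, altSign d * x d) ^ 2 := by
  rw [dotProduct, sq, Finset.sum_mul]
  exact Finset.sum_congr rfl fun i _ => by rw [altMat_mulVec]; ring

theorem altMat_mulVec_shifted (hne : Even n) (hf : IsZeroProfile f) (j : ZMod n) :
    (altMat n).mulVec (shifted f j) = 0 := by
  funext i
  rw [altMat_mulVec]
  have h := sum_altSign_mul_shifted hne hf (j - 3)
  have h2 : ∀ d, shifted f d (j - 3) = shifted f j d := fun d => by
    rw [shifted, shifted, ← hf.symm]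
    congr 1
    ring
  simp only [h2] at h
  rw [h, mul_zero]
  rfl

/-- The row is killed by p(S) and by S^n − 1. The quadratic factors of p are coprime to X^n − 1, so
S + 1 alone already kills it. -/
theorem IsFactored.row_alternates (h : IsFactored p ζ f) {φ : ZMod n → ℝ}
    (hφ : ∀ j, ∑ d, f d * φ (j + d) = 0) (i : ZMod n) : φ (i + 1) = -φ i := by
  obtain ⟨a, ha, hp⟩ := h.factor
  have h1 : aeval (shiftEnd ℝ (1 : ZMod n)) p φ = 0 := by
    funext j
    rw [aeval_shiftEnd_apply h.natDegree_lt]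
    simp only [mul_one, ← h.coeff]
    exact hφ j
  have hcop : IsCoprime (∏ j, quadFactor (ζ j)) (X ^ n - 1) :=
    IsCoprime.prod_left fun j _ => isCoprime_quadFactor (h.sin_ne j)
  obtain ⟨r, s, hrs⟩ := hcop
  set S := shiftEnd ℝ (1 : ZMod n)
  have h2 : aeval S (C a * (X + 1)) φ = 0 := by
    have h3 : C a * (X + 1) = r * p + s * (C a * (X + 1)) * (X ^ n - 1) := by
      rw [hp]
      linear_combination (-C a * (X + 1)) * hrs
    rw [h3, map_add, LinearMap.add_apply, map_mul, Module.End.mul_apply, h1, map_zero, map_mul _ _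
      (X ^ n - 1), aeval_shiftEnd_X_pow_sub_one, mul_zero, LinearMap.zero_apply, add_zero]
  have h3 := congrFun h2 i
  simp only [map_mul, map_add, aeval_C, aeval_X, map_one, Module.End.mul_apply,
    Module.algebraMap_end_apply, Pi.smul_apply, LinearMap.add_apply, Pi.add_apply,
    Module.End.one_apply, smul_eq_mul, Pi.zero_apply, S, shiftEnd_apply] at h3
  rw [← mul_add] at h3
  have := (mul_eq_zero.1 h3).resolve_left ha.ne'
  linarith

theorem eq_altSign_mul_of_alternates (hne : Even n) {φ : ZMod n → ℝ}
    (hφ : ∀ i, φ (i + 1) = -φ i) (i : ZMod n) : φ i = altSign i * φ 0 := by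
  obtain ⟨k, rfl⟩ : ∃ k : ℕ, (k : ZMod n) = i := ⟨i.val, ZMod.natCast_zmod_val i⟩
  rw [altSign_natCast hne]
  induction k with
  | zero => simp
  | succ k ih => rw [Nat.cast_succ, hφ, ih, pow_succ]; ring

/-- The symmetric matrices that annihilate all generating zeros. -/
theorem IsFactored.eq_smul_altMat (h : IsFactored p ζ f) {Y : Matrix (ZMod n) (ZMod n) ℝ}
    (hY : Y.IsSymm) (h0 : ∀ j, Y.mulVec (shifted f j) = 0) : Y = Y 0 0 • altMat n := by
  have hrow : ∀ r i, Y r (i + 1) = -Y r i := fun r => h.row_alternates fun j => by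
    have := congrFun (h0 j) r
    rw [Matrix.mulVec, dotProduct, ← Equiv.sum_comp (Equiv.addLeft j)] at this
    simp only [Equiv.coe_addLeft, shifted, add_sub_cancel_left] at this
    rw [← Pi.zero_apply (M := fun _ => ℝ) r, ← this]
    exact Finset.sum_congr rfl fun d _ => mul_comm _ _
  ext i j
  rw [eq_altSign_mul_of_alternates h.even (hrow i) j, ← hY.apply i 0,
    eq_altSign_mul_of_alternates h.even (hrow 0) i, Matrix.smul_apply, altMat, Matrix.of_apply,
    smul_eq_mul]
  ring

variable {A : Matrix (ZMod n) (ZMod n) ℝ}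

/-- Subtracting the multiple of `fundMat n ζ` with the same α leaves a symmetric matrix that kills
every u^j. Copositivity plays no role here. -/
theorem IsFactored.exists_decomposition (h : IsFactored p ζ f) (hf : IsZeroProfile f)
    (hA : A.IsSymm) {α : ℝ}
    (hα : ∀ x j, x ⬝ᵥ A.mulVec (shifted f j) = α * (x (j - 2) + x (j - 1))) :
    ∃ γ lam : ℝ, 0 < γ ∧ A = (α / γ) • fundMat n ζ + lam • altMat n := by
  obtain ⟨γ, hγ, hγ'⟩ := h.exists_gap hf
  set Y := A - (α / γ) • fundMat n ζ with hY
  have hYs : Y.IsSymm := hA.sub (h.fundMat_isSymm.smul _)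
  have hY0 : ∀ j, Y.mulVec (shifted f j) = 0 := by
    intro j
    refine dotProduct_eq_zero _ fun x => ?_
    rw [dotProduct_comm, hY, Matrix.sub_mulVec, dotProduct_sub, Matrix.smul_mulVec, dotProduct_smul,
      hα, hγ', smul_eq_mul]
    field_simp
    ring
  refine ⟨γ, Y 0 0, hγ, ?_⟩
  rw [← h.eq_smul_altMat hYs hY0, hY]
  abel

theorem sum_altSign_mul_coeff {g : ℝ[X]} (hg : g.natDegree < n) :
    ∑ d : ZMod n, altSign d * g.coeff d.val = g.eval (-1) := by
  rw [eval_eq_sum_range' hg, sum_range_eq_sum_zmod]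
  exact Finset.sum_congr rfl fun d _ => mul_comm _ _

/-- The form of the matrices in question on windows, in terms of polynomials. -/
theorem IsFactored.quadForm_coeff (h : IsFactored p ζ f) (c lam : ℝ) {g : ℝ[X]}
    (hg : g.natDegree + 2 < n) :
    (fun d : ZMod n => g.coeff d.val) ⬝ᵥ
      (c • fundMat n ζ + lam • altMat n).mulVec (fun d => g.coeff d.val) =
      c * ∑ j, fundWeight n ζ j * Complex.normSq (aeval (Complex.exp (ζ j * Complex.I)) g) +
        lam * g.eval (-1) ^ 2 := by
  obtain ⟨h1, h2⟩ := coeff_val_eq_zero h.five_lt hg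
  rw [Matrix.add_mulVec, dotProduct_add, Matrix.smul_mulVec, Matrix.smul_mulVec, dotProduct_smul,
    dotProduct_smul, quadForm_altMat, sum_altSign_mul_coeff (by omega), fundMat,
    quadForm_circMat_eq h.five_lt h.foldable h1 h2, trigSeq_window_eq (by omega)]
  rfl

theorem one_add_cos_pos {θ : ℝ} (hθ : θ ∈ Set.Ioo 0 Real.pi) : 0 < 1 + Real.cos θ := by
  have := Real.cos_lt_cos_of_nonneg_of_le_pi hθ.1.le le_rfl hθ.2
  rw [Real.cos_pi] at this
  linarith

/-- Testing on a window with the cofactor of `X + 1`. -/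
theorem IsFactored.lam_nonneg (h : IsFactored p ζ f) (hf : IsZeroProfile f) {c lam : ℝ}
    (hA : InFace f (c • fundMat n ζ + lam • altMat n)) : 0 ≤ lam := by
  have hg : (∏ j, quadFactor (ζ j)).natDegree + 2 < n := by
    rw [natDegree_prod_quadFactor, Finset.card_univ, Fintype.card_fin, h.size]
    omega
  obtain ⟨h1, h2⟩ := coeff_val_eq_zero h.five_lt hg
  have hpos := hA.quadForm_nonneg hf 0 (x := fun d => (∏ j, quadFactor (ζ j)).coeff d.val)
    (by rwa [zero_sub]) (by rwa [zero_sub])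
  -- The cofactor vanishes at every exp(iζ_j), so only λ g(−1)² survives.
  rw [h.quadForm_coeff c lam hg, Finset.sum_eq_zero, mul_zero, zero_add] at hpos
  · refine nonneg_of_mul_nonneg_left hpos (pow_pos ?_ 2)
    rw [eval_prod]
    refine Finset.prod_pos fun j _ => ?_
    have := one_add_cos_pos (h.mem j)
    simp only [quadFactor, eval_add, eval_sub, eval_pow, eval_X, eval_mul, eval_C, eval_one]
    linarith
  · intro j _
    rw [map_prod, Finset.prod_eq_zero (Finset.mem_univ j) (aeval_quadFactor_self (ζ j)), map_zero,
      mul_zero]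

/-- Testing on a window with the cofactor of a quadratic factor. -/
theorem IsFactored.weight_nonneg (h : IsFactored p ζ f) (hf : IsZeroProfile f) {c lam : ℝ}
    (hA : InFace f (c • fundMat n ζ + lam • altMat n)) (j : Fin m) :
    0 ≤ c * fundWeight n ζ j := by
  set g : ℝ[X] := (X + 1) * ∏ l ∈ Finset.univ.erase j, quadFactor (ζ l) with hgdef
  have hg : g.natDegree + 2 < n := by
    rw [natDegree_X_add_one_mul_prod, Finset.card_erase_of_mem (Finset.mem_univ j),
      Finset.card_univ, Fintype.card_fin, h.size]
    omega
  obtain ⟨h1, h2⟩ := coeff_val_eq_zero h.five_lt hg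
  have hpos := hA.quadForm_nonneg hf 0 (x := fun d => g.coeff d.val)
    (by rwa [zero_sub]) (by rwa [zero_sub])
  have heval : g.eval (-1) = 0 := by rw [hgdef, eval_mul]; simp
  -- Here g vanishes at −1 and at exp(iζ_l) for l ≠ j, so only the term with weight j survives.
  rw [h.quadForm_coeff c lam hg, heval, Finset.sum_eq_single j] at hpos
  · rw [← mul_assoc, zero_pow two_ne_zero, mul_zero, add_zero] at hpos
    refine nonneg_of_mul_nonneg_left hpos (Complex.normSq_pos.2 ?_)
    rw [hgdef, map_mul, map_prod]
    refine mul_ne_zero ?_ (Finset.prod_ne_zero_iff.2 fun l hl => ?_)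
    · simpa using exp_add_one_ne_zero (h.mem j)
    · rw [aeval_exp_quadFactor]
      refine mul_ne_zero (Complex.exp_ne_zero _) (Complex.ofReal_ne_zero.2 ?_)
      have := (injective_cos_comp h.inj h.mem).ne (Finset.ne_of_mem_erase hl)
      exact mul_ne_zero two_ne_zero (sub_ne_zero.2 this.symm)
  · intro l _ hl
    rw [hgdef, map_mul, map_prod, Finset.prod_eq_zero (Finset.mem_erase.2 ⟨hl, Finset.mem_univ l⟩)
      (aeval_quadFactor_self (ζ l)), mul_zero, map_zero, mul_zero]
  · simp

/-- With positive weights the combinations of the two matrices are copositive. -/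
theorem IsFactored.inFace_of_weight_pos (h : IsFactored p ζ f) (hf : IsZeroProfile f)
    (hw : ∀ j, 0 < fundWeight n ζ j) {c lam : ℝ} (hc : 0 ≤ c) (hlam : 0 ≤ lam) :
    InFace f (c • fundMat n ζ + lam • altMat n) := by
  obtain ⟨γ, hγ, hγ'⟩ := h.exists_gap hf
  have hsymm : (c • fundMat n ζ + lam • altMat n).IsSymm :=
    (h.fundMat_isSymm.smul c).add (altMat_isSymm.smul lam)
  have hprod : ∀ x j, x ⬝ᵥ (c • fundMat n ζ + lam • altMat n).mulVec (shifted f j) =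
      c * γ * (x (j - 2) + x (j - 1)) := by
    intro x j
    rw [Matrix.add_mulVec, dotProduct_add, Matrix.smul_mulVec, Matrix.smul_mulVec,
      altMat_mulVec_shifted h.even hf, smul_zero, dotProduct_zero, add_zero, dotProduct_smul, hγ',
      smul_eq_mul, mul_assoc]
  have hzero : ∀ j, shifted f j ⬝ᵥ (c • fundMat n ζ + lam • altMat n).mulVec (shifted f j) = 0 := by
    intro j
    rw [hprod, shifted, shifted, show (j - 2 - j : ZMod n) = -2 by ring,
      show (j - 1 - j : ZMod n) = -1 by ring, hf.neg_one, hf.neg_two]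
    ring
  refine ⟨hsymm, fun x hx => ?_, hzero⟩
  have hoff : ∀ y : ZMod n → ℝ, (∀ i, 0 ≤ y i) → y (-1) = 0 →
      0 ≤ y ⬝ᵥ (c • fundMat n ζ + lam • altMat n).mulVec y := by
    intro y hy hy1
    rw [Matrix.add_mulVec, dotProduct_add, Matrix.smul_mulVec, Matrix.smul_mulVec, dotProduct_smul,
      dotProduct_smul, quadForm_altMat, smul_eq_mul, smul_eq_mul]
    refine add_nonneg (mul_nonneg hc ?_) (by positivity)
    refine le_trans ?_ (le_quadForm_circMat h.five_lt h.foldable (by linarith [h.gap]) hy hy1)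
    rw [sum_mul_trigSeq]
    exact Finset.sum_nonneg fun j _ => mul_nonneg (hw j).le (by positivity)
  have hrot : ∀ (y : ZMod n → ℝ) (k : ZMod n), (∀ i, 0 ≤ y i) → y k = 0 →
      0 ≤ y ⬝ᵥ (c • fundMat n ζ + lam • altMat n).mulVec y := by
    intro y k hy hyk
    have hinv : ∀ i j, (c • fundMat n ζ + lam • altMat n) (i + (k + 1)) (j + (k + 1)) =
        (c • fundMat n ζ + lam • altMat n) i j := by
      intro i j
      simp only [Matrix.add_apply, Matrix.smul_apply, fundMat, circMat_add, altMat, Matrix.of_apply,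
        altSign_add h.even _ (k + 1)]
      have := altSign_mul_self (k + 1)
      linear_combination (exp := 1) lam * altSign i * altSign j * this
    have := hoff (fun i => y (i + (k + 1))) (fun i => hy _) (by
      rw [show (-1 + (k + 1) : ZMod n) = k by ring, hyk])
    refine this.trans_eq ?_
    simp only [dotProduct, Matrix.mulVec]
    rw [← Equiv.sum_comp (Equiv.addRight (k + 1)) fun i => y i * _]
    refine Finset.sum_congr rfl fun i _ => ?_
    rw [← Equiv.sum_comp (Equiv.addRight (k + 1)) fun j => _ * y j]
    simp only [Equiv.coe_addRight, hinv]
  -- The minimal ratio is the largest t for which x − t u^0 is nonnegative. The remainder y vanishes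
  -- at some position, which a rotation carries to −1.
  obtain ⟨i, hi, hmin⟩ := Finset.exists_min_image (Finset.univ.filter fun i => 0 < shifted f 0 i)
    (fun i => x i / shifted f 0 i) ⟨0, by
      simpa [shifted] using hf.zero_pos h.five_lt⟩
  simp only [Finset.mem_filter, Finset.mem_univ, true_and] at hi hmin
  set t := x i / shifted f 0 i with ht
  have ht0 : 0 ≤ t := div_nonneg (hx i) hi.le
  have hsh : ∀ k, 0 ≤ shifted f 0 k := fun k => hf.nonneg _
  set y := x + (-t) • shifted f 0 with hy
  have hy0 : ∀ k, 0 ≤ y k := by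
    intro k
    simp only [hy, Pi.add_apply, Pi.smul_apply, smul_eq_mul]
    rcases (hsh k).eq_or_lt with h' | h'
    · rw [← h', mul_zero, add_zero]
      exact hx k
    · have := (le_div_iff₀ h').1 (hmin k h')
      linarith
  have hyi : y i = 0 := by
    simp only [hy, Pi.add_apply, Pi.smul_apply, smul_eq_mul, ht]
    field_simp
    ring
  have hxy : x = y + t • shifted f 0 := by rw [hy, neg_smul]; abel
  -- The square term of u^0 vanishes, and the cross term is 2t·cγ(y_{−2} + y_{−1}) ≥ 0.
  rw [hxy, quadForm_add_smul hsymm, hzero, dotProduct_mulVec_symm hsymm (shifted f 0), hprod]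
  have := hrot y i hy0 hyi
  have h1 := hy0 (0 - 2)
  have h2 := hy0 (0 - 1)
  have : 0 ≤ 2 * t * (c * γ * (y (0 - 2) + y (0 - 1))) := by positivity
  linarith

end Factored

/-! ### Averaging over circular shifts -/

section Average

variable {n : ℕ}

theorem shifted_shifted {R : Type*} (f : ZMod n → R) (j k : ZMod n) :
    shifted (shifted f j) k = shifted f (j + k) := by
  funext i
  simp only [shifted]
  congr 1
  ring

variable [NeZero n]

/-- The sum of all simultaneous circular shifts of a matrix. -/
def circSum (A : Matrix (ZMod n) (ZMod n) ℝ) : Matrix (ZMod n) (ZMod n) ℝ :=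
  Matrix.of fun i j => ∑ k, A (i + k) (j + k)

theorem circSum_add (A : Matrix (ZMod n) (ZMod n) ℝ) (i j k : ZMod n) :
    circSum A (i + k) (j + k) = circSum A i j := by
  simp only [circSum, Matrix.of_apply, add_assoc]
  exact Equiv.sum_comp (Equiv.addLeft k) fun l => A (i + l) (j + l)

theorem dotProduct_circSum_mulVec (A : Matrix (ZMod n) (ZMod n) ℝ) (x y : ZMod n → ℝ) :
    x ⬝ᵥ (circSum A).mulVec y = ∑ k, shifted x k ⬝ᵥ A.mulVec (shifted y k) := by
  have h : ∀ k, shifted x k ⬝ᵥ A.mulVec (shifted y k) =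
      ∑ i, x i * ∑ j, A (i + k) (j + k) * y j := by
    intro k
    simp only [dotProduct, Matrix.mulVec, shifted]
    rw [← Equiv.sum_comp (Equiv.addRight k)]
    refine Finset.sum_congr rfl fun i _ => ?_
    rw [← Equiv.sum_comp (Equiv.addRight k) fun j => _ * y (j - k)]
    simp only [Equiv.coe_addRight, add_sub_cancel_right]
  simp only [h]
  rw [dotProduct]
  conv_rhs => rw [Finset.sum_comm]
  refine Finset.sum_congr rfl fun i _ => ?_
  rw [← Finset.mul_sum]
  congr 1
  simp only [Matrix.mulVec, dotProduct, circSum, Matrix.of_apply, Finset.sum_mul]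
  rw [Finset.sum_comm]

variable {f : ZMod n → ℝ} {A : Matrix (ZMod n) (ZMod n) ℝ}

theorem InFace.circSum (hA : InFace f A) : InFace f (circSum A) where
  symm := by
    ext i j
    simp only [CircCop.circSum, Matrix.transpose_apply, Matrix.of_apply]
    exact Finset.sum_congr rfl fun k _ => hA.symm.apply _ _
  cop x hx := by
    rw [dotProduct_circSum_mulVec]
    exact Finset.sum_nonneg fun k _ => hA.cop _ fun i => hx _
  zero j := by
    rw [dotProduct_circSum_mulVec]
    exact Finset.sum_eq_zero fun k _ => by rw [shifted_shifted, hA.zero]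

theorem dotProduct_circSum_mulVec_shifted {α : ℝ}
    (hα : ∀ x j, x ⬝ᵥ A.mulVec (shifted f j) = α * (x (j - 2) + x (j - 1))) (x : ZMod n → ℝ)
    (j : ZMod n) :
    x ⬝ᵥ (circSum A).mulVec (shifted f j) = n * α * (x (j - 2) + x (j - 1)) := by
  rw [dotProduct_circSum_mulVec]
  have : ∀ k, shifted x k ⬝ᵥ A.mulVec (shifted (shifted f j) k) = α * (x (j - 2) + x (j - 1)) := by
    intro k
    rw [shifted_shifted, hα, shifted, shifted, show (j + k - 2 - k : ZMod n) = j - 2 by ring,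
      show (j + k - 1 - k : ZMod n) = j - 1 by ring]
  simp only [this, Finset.sum_const, Finset.card_univ, ZMod.card, nsmul_eq_mul]
  ring

end Average

/-! ### Complexification: polynomials as vectors on the cycle -/

section ComplexForm

variable {n : ℕ}

/-- The coefficient vector of a polynomial, folded into the cycle. -/
noncomputable def cyc (n : ℕ) (g : ℂ[X]) : ZMod n → ℂ :=
  aeval (shiftEnd ℂ (-1 : ZMod n)) g (Pi.single 0 1)

theorem cyc_sub (g h : ℂ[X]) : cyc n (g - h) = cyc n g - cyc n h := by
  rw [cyc, map_sub, LinearMap.sub_apply]; rfl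

theorem cyc_C_mul (a : ℂ) (g : ℂ[X]) : cyc n (C a * g) = a • cyc n g := by
  rw [cyc, map_mul, Module.End.mul_apply, aeval_C, Module.algebraMap_end_apply]; rfl

theorem cyc_X_mul (g : ℂ[X]) : cyc n (X * g) = shifted (cyc n g) 1 := by
  funext i
  rw [cyc, map_mul, Module.End.mul_apply, aeval_X, shiftEnd_apply, ← sub_eq_add_neg]
  rfl

theorem cyc_linear_mul (g : ℂ[X]) (ω : ℂ) :
    cyc n ((X - C ω) * g) = shifted (cyc n g) 1 - ω • cyc n g := by
  rw [sub_mul, cyc_sub, cyc_X_mul, cyc_C_mul]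

variable [NeZero n]

theorem cyc_apply {g : ℂ[X]} (hg : g.natDegree < n) (i : ZMod n) : cyc n g i = g.coeff i.val := by
  rw [cyc, aeval_shiftEnd_apply hg, Finset.sum_eq_single i]
  · simp
  · intro d _ hd
    rw [Pi.single_eq_of_ne, mul_zero]
    intro h
    exact hd (by linear_combination -h)
  · simp

theorem cyc_window (hn : 5 < n) {g : ℂ[X]} (hg : g.natDegree + 2 < n) :
    cyc n g (-1) = 0 ∧ cyc n g (-2) = 0 := by
  have h1 := natCast_val_neg_one hn
  have h2 := natCast_val_neg_two hn
  rw [cyc_apply (by omega), cyc_apply (by omega)]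
  exact ⟨coeff_eq_zero_of_natDegree_lt (by omega), coeff_eq_zero_of_natDegree_lt (by omega)⟩

/-- The complexification of a real matrix, applied to a vector. -/
noncomputable def cMulVec (A : Matrix (ZMod n) (ZMod n) ℝ) : (ZMod n → ℂ) →ₗ[ℂ] (ZMod n → ℂ) :=
  (A.map Complex.ofReal).mulVecLin

theorem cMulVec_apply (A : Matrix (ZMod n) (ZMod n) ℝ) (v : ZMod n → ℂ) (i : ZMod n) :
    cMulVec A v i = ∑ j, (A i j : ℂ) * v j := rfl

theorem cMulVec_ofReal (A : Matrix (ZMod n) (ZMod n) ℝ) (x : ZMod n → ℝ) (i : ZMod n) :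
    cMulVec A (fun j => (x j : ℂ)) i = (A.mulVec x i : ℝ) := by
  rw [cMulVec_apply, Matrix.mulVec, dotProduct]
  push_cast
  rfl

theorem cMulVec_shifted {A : Matrix (ZMod n) (ZMod n) ℝ}
    (hA : ∀ i j k, A (i + k) (j + k) = A i j) (v : ZMod n → ℂ) (k : ZMod n) :
    cMulVec A (shifted v k) = shifted (cMulVec A v) k := by
  funext i
  rw [shifted, cMulVec_apply, cMulVec_apply, ← Equiv.sum_comp (Equiv.addRight k)]
  refine Finset.sum_congr rfl fun j _ => ?_
  simp only [Equiv.coe_addRight, shifted, add_sub_cancel_right]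
  rw [← hA (i - k) j k, sub_add_cancel]

/-- The sesquilinear form defined by a real matrix. -/
noncomputable def sesqForm (A : Matrix (ZMod n) (ZMod n) ℝ) (v w : ZMod n → ℂ) : ℂ :=
  ∑ i, starRingEnd ℂ (v i) * cMulVec A w i

theorem sesqForm_sub (A : Matrix (ZMod n) (ZMod n) ℝ) (v w w' : ZMod n → ℂ) :
    sesqForm A v (w - w') = sesqForm A v w - sesqForm A v w' := by
  simp only [sesqForm, map_sub, Pi.sub_apply, mul_sub, Finset.sum_sub_distrib]

theorem sesqForm_smul (A : Matrix (ZMod n) (ZMod n) ℝ) (v w : ZMod n → ℂ) (a : ℂ) :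
    sesqForm A v (a • w) = a * sesqForm A v w := by
  simp only [sesqForm, map_smul, Pi.smul_apply, smul_eq_mul, Finset.mul_sum]
  exact Finset.sum_congr rfl fun _ _ => by ring

theorem sesqForm_conj {A : Matrix (ZMod n) (ZMod n) ℝ} (hA : A.IsSymm) (v w : ZMod n → ℂ) :
    starRingEnd ℂ (sesqForm A v w) = sesqForm A w v := by
  simp only [sesqForm, cMulVec_apply, map_sum, map_mul, Complex.conj_conj, Complex.conj_ofReal,
    Finset.mul_sum]
  rw [Finset.sum_comm]
  refine Finset.sum_congr rfl fun i _ => Finset.sum_congr rfl fun j _ => ?_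
  rw [hA.apply]
  ring

theorem sesqForm_shifted {A : Matrix (ZMod n) (ZMod n) ℝ}
    (hA : ∀ i j k, A (i + k) (j + k) = A i j) (v w : ZMod n → ℂ) (k : ZMod n) :
    sesqForm A (shifted v k) (shifted w k) = sesqForm A v w := by
  simp only [sesqForm, cMulVec_shifted hA]
  exact Equiv.sum_comp (Equiv.subRight k) fun i => starRingEnd ℂ (v i) * cMulVec A w i

/-- The real and imaginary parts of v lie in the window of u^0, where A is positive semi-definite.
Their values add up to zero, so both are killed by the principal submatrix. -/
theorem cMulVec_eq_zero_of_sesqForm_eq_zero {f : ZMod n → ℝ} {A : Matrix (ZMod n) (ZMod n) ℝ}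
    (hA : InFace f A) (hf : IsZeroProfile f) {v : ZMod n → ℂ} (h1 : v (-1) = 0) (h2 : v (-2) = 0)
    (h0 : sesqForm A v v = 0) {i : ZMod n} (hi1 : i ≠ -1) (hi2 : i ≠ -2) : cMulVec A v i = 0 := by
  set x : ZMod n → ℝ := fun i => (v i).re with hx
  set y : ZMod n → ℝ := fun i => (v i).im with hy
  have hmul : ∀ i, cMulVec A v i = (A.mulVec x i : ℝ) + (A.mulVec y i : ℝ) * Complex.I := by
    intro i
    rw [← cMulVec_ofReal, ← cMulVec_ofReal, cMulVec_apply, cMulVec_apply, cMulVec_apply,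
      Finset.sum_mul, ← Finset.sum_add_distrib]
    refine Finset.sum_congr rfl fun j _ => ?_
    conv_lhs => rw [← Complex.re_add_im (v j)]
    ring
  have hre : x ⬝ᵥ A.mulVec x + y ⬝ᵥ A.mulVec y = 0 := by
    have := congrArg Complex.re h0
    rw [sesqForm, Complex.re_sum, Complex.zero_re] at this
    rw [← this, dotProduct, dotProduct, ← Finset.sum_add_distrib]
    refine Finset.sum_congr rfl fun i _ => ?_
    rw [hmul]
    simp [hx, hy]
  have hS : ∀ z : ZMod n → ℝ, (∀ i ∉ ({-1, -2}ᶜ : Set (ZMod n)), z i = 0) → 0 ≤ z ⬝ᵥ A.mulVec z := by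
    intro z hz
    exact hA.quadForm_nonneg hf 0 (hz _ (by simp)) (hz _ (by simp))
  have hxS : ∀ i ∉ ({-1, -2}ᶜ : Set (ZMod n)), x i = 0 := by
    intro i hi
    simp only [Set.mem_compl_iff, Set.mem_insert_iff, Set.mem_singleton_iff, not_not] at hi
    rcases hi with rfl | rfl <;> simp [hx, h1, h2]
  have hyS : ∀ i ∉ ({-1, -2}ᶜ : Set (ZMod n)), y i = 0 := by
    intro i hi
    simp only [Set.mem_compl_iff, Set.mem_insert_iff, Set.mem_singleton_iff, not_not] at hi
    rcases hi with rfl | rfl <;> simp [hy, h1, h2]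
  have hx0 := hS x hxS
  have hy0 := hS y hyS
  have hi : i ∈ ({-1, -2}ᶜ : Set (ZMod n)) := by simp [hi1, hi2]
  rw [hmul, mulVec_eq_zero_of_quadForm_eq_zero hA.symm hS hxS (by linarith) hi,
    mulVec_eq_zero_of_quadForm_eq_zero hA.symm hS hyS (by linarith) hi]
  simp

end ComplexForm

/-! ### Roots of the polynomial of the profile -/

section Roots

variable {n : ℕ} [NeZero n] {f : ZMod n → ℝ} {A : Matrix (ZMod n) (ZMod n) ℝ} {α : ℝ} {p : ℝ[X]}

/-- Circulant matrices in the face, with a positive product with the generating zeros, together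
with the polynomial of the profile. -/
structure IsCircWitness (p : ℝ[X]) (f : ZMod n → ℝ) (A : Matrix (ZMod n) (ZMod n) ℝ) (α : ℝ) :
    Prop where
  five_lt : 5 < n
  even : Even n
  profile : IsZeroProfile f
  inFace : InFace f A
  circ : ∀ i j k, A (i + k) (j + k) = A i j
  prod : ∀ x j, x ⬝ᵥ A.mulVec (shifted f j) = α * (x (j - 2) + x (j - 1))
  pos : 0 < α
  coeff : ∀ d, f d = p.coeff d.val
  natDegree : p.natDegree + 3 = n

theorem IsCircWitness.cMulVec_cyc (h : IsCircWitness p f A α) :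
    cMulVec A (cyc n (p.map (algebraMap ℝ ℂ))) =
      (α : ℂ) • (Pi.single (-2) 1 + Pi.single (-1) 1) := by
  have h1 : cyc n (p.map (algebraMap ℝ ℂ)) = fun j => ((shifted f 0 j : ℝ) : ℂ) := by
    funext j
    have := h.natDegree
    rw [cyc_apply (by rw [natDegree_map]; omega), coeff_map, shifted, sub_zero, h.coeff]
    rfl
  rw [h1]
  funext i
  rw [cMulVec_ofReal, ← single_one_dotProduct i (A.mulVec (shifted f 0)), h.prod, zero_sub, zero_sub]
  simp only [Pi.smul_apply, Pi.add_apply, smul_eq_mul]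
  push_cast
  simp only [Pi.single_apply, eq_comm (a := i)]
  split_ifs <;> simp

/-- The vector of g is supported in the window of u^0, and A u^0 is supported outside it. -/
theorem IsCircWitness.sesqForm_cyc (h : IsCircWitness p f A α) {g : ℂ[X]}
    (hg : g.natDegree + 2 < n) :
    sesqForm A (cyc n g) (cyc n (p.map (algebraMap ℝ ℂ))) = 0 := by
  obtain ⟨h1, h2⟩ := cyc_window h.five_lt hg
  rw [sesqForm, h.cMulVec_cyc]
  refine Finset.sum_eq_zero fun i _ => ?_
  by_cases hi1 : i = -1
  · rw [hi1, h1]; simp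
  by_cases hi2 : i = -2
  · rw [hi2, h2]; simp
  simp [hi1, hi2]

section LinearFactor

variable {ω : ℂ} {g : ℂ[X]}

theorem IsCircWitness.natDegree_cofactor (h : IsCircWitness p f A α)
    (hg : p.map (algebraMap ℝ ℂ) = (X - C ω) * g) : g.natDegree + 4 = n := by
  have h1 := congrArg Polynomial.natDegree hg
  have := h.natDegree
  have := h.five_lt
  have hg0 : g ≠ 0 := by
    rintro rfl
    rw [mul_zero, natDegree_zero, natDegree_map] at h1
    omega
  rw [natDegree_map, (monic_X_sub_C ω).natDegree_mul' hg0, natDegree_X_sub_C] at h1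
  omega

/-- Orthogonality of p = (X − ω)g to the window: tested there, multiplication by X acts on g as the
scalar ω. -/
theorem IsCircWitness.sesqForm_eigen (h : IsCircWitness p f A α)
    (hg : p.map (algebraMap ℝ ℂ) = (X - C ω) * g) {q : ℂ[X]} (hq : q.natDegree + 2 < n) :
    sesqForm A (cyc n q) (shifted (cyc n g) 1) = ω * sesqForm A (cyc n q) (cyc n g) := by
  have := h.sesqForm_cyc hq
  rw [hg, cyc_linear_mul, sesqForm_sub, sesqForm_smul] at this
  exact sub_eq_zero.1 this

/-- An isotropic cofactor is mapped to a multiple of a unit vector. -/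
theorem IsCircWitness.of_isotropic (h : IsCircWitness p f A α)
    (hg : p.map (algebraMap ℝ ℂ) = (X - C ω) * g) (h0 : sesqForm A (cyc n g) (cyc n g) = 0) :
    ω = -1 ∧ cMulVec A (cyc n g) = (α : ℂ) • Pi.single (-2) 1 := by
  have hdeg := h.natDegree_cofactor hg
  have hw := cyc_window h.five_lt (g := g) (by omega)
  have hw' := cyc_window h.five_lt (g := X * g)
    (by have := natDegree_mul_le (p := X) (q := g); rw [natDegree_X] at this; omega)
  have hne := fun k => zmod_intCast_ne_zero (k := k) h.five_lt
  -- Since g has degree n − 4, both g and X g fit into the window. The kernel property of X g at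
  -- position 0, shifted back, covers −1 and leaves only −2.
  have hv : ∀ i : ZMod n, i ≠ -2 → cMulVec A (cyc n g) i = 0 := by
    intro i hi
    by_cases hi1 : i = -1
    · have h3 := cMulVec_eq_zero_of_sesqForm_eq_zero h.inFace h.profile hw'.1 hw'.2
        (by rw [cyc_X_mul, sesqForm_shifted h.circ, h0]) (i := i + 1)
        (fun h => hne 1 (by norm_num) (by norm_num) (by push_cast; linear_combination h - hi1))
        (fun h => hne 2 (by norm_num) (by norm_num) (by push_cast; linear_combination h - hi1))
      rw [cyc_X_mul, cMulVec_shifted h.circ, shifted, add_sub_cancel_right] at h3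
      exact h3
    · exact cMulVec_eq_zero_of_sesqForm_eq_zero h.inFace h.profile hw.1 hw.2 h0 hi1 hi
  -- Compare (S − ω) A g with α(e_{−2} + e_{−1}): the entry at −1 shows (A g)_{−2} = α, and the
  -- entry at −2 gives −ωα = α.
  have hp := h.cMulVec_cyc
  rw [hg, cyc_linear_mul, map_sub, map_smul, cMulVec_shifted h.circ] at hp
  have h12 : (-1 : ZMod n) ≠ -2 := fun h => hne 1 (by norm_num) (by norm_num) (by
    push_cast; linear_combination h)
  have e1 := congrFun hp (-1)
  have e2 := congrFun hp (-2)
  simp only [Pi.sub_apply, Pi.smul_apply, shifted, smul_eq_mul, Pi.add_apply, Pi.single_eq_same,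
    Pi.single_eq_of_ne h12, Pi.single_eq_of_ne h12.symm] at e1 e2
  rw [hv (-1) h12, show (-1 - 1 : ZMod n) = -2 by ring] at e1
  rw [hv (-2 - 1) (fun h => hne 1 (by norm_num) (by norm_num) (by
    push_cast; linear_combination -h))] at e2
  have hα : (α : ℂ) ≠ 0 := Complex.ofReal_ne_zero.2 h.pos.ne'
  have e3 : cMulVec A (cyc n g) (-2) = α := by linear_combination e1
  refine ⟨?_, ?_⟩
  · rw [e3] at e2
    refine mul_right_cancel₀ hα ?_
    linear_combination -e2
  · funext i
    by_cases hi : i = -2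
    · rw [hi, e3]; simp
    · rw [hv i hi]; simp [hi]

/-- The roots of the polynomial of the profile are unimodular. -/
theorem IsCircWitness.mul_conj_root (h : IsCircWitness p f A α)
    (hg : p.map (algebraMap ℝ ℂ) = (X - C ω) * g) : ω * starRingEnd ℂ ω = 1 := by
  have hdeg := h.natDegree_cofactor hg
  have hX : (X * g).natDegree + 2 < n := by
    have := natDegree_mul_le (p := X) (q := g); rw [natDegree_X] at this; omega
  by_cases h0 : sesqForm A (cyc n g) (cyc n g) = 0
  · rw [(h.of_isotropic hg h0).1]; simp
  -- ⟨Xg, Xg⟩ = ω⟨Xg, g⟩ = ωω̄⟨g, g⟩, and by shift invariance the left side is ⟨g, g⟩ ≠ 0.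
  · have e1 := h.sesqForm_eigen hg hX
    have e2 := h.sesqForm_eigen hg (q := g) (by omega)
    rw [cyc_X_mul, sesqForm_shifted h.circ, ← sesqForm_conj h.inFace.symm (cyc n g) (shifted (cyc n g) 1), e2, map_mul,
      sesqForm_conj h.inFace.symm] at e1
    refine mul_right_cancel₀ h0 ?_
    linear_combination -e1

/-- The roots of the polynomial of the profile are simple. -/
theorem IsCircWitness.not_double_root (h : IsCircWitness p f A α) {q : ℂ[X]}
    (hg : p.map (algebraMap ℝ ℂ) = (X - C ω) * ((X - C ω) * q)) : False := by
  have hω := h.mul_conj_root hg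
  have hdeg := h.natDegree_cofactor hg
  set g := (X - C ω) * q with hgq
  have hq0 : q ≠ 0 := by
    rintro rfl
    have := h.five_lt
    have := h.natDegree
    rw [hgq, mul_zero, mul_zero, Polynomial.map_eq_zero] at hg
    rw [hg, natDegree_zero] at this
    omega
  have hqdeg : q.natDegree + 5 = n := by
    rw [hgq, (monic_X_sub_C ω).natDegree_mul' hq0, natDegree_X_sub_C] at hdeg
    omega
  have hX : (X * q).natDegree + 2 < n := by
    have := natDegree_mul_le (p := X) (q := q); rw [natDegree_X] at this; omega
  have e1 := h.sesqForm_eigen hg hX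
  rw [cyc_X_mul, sesqForm_shifted h.circ] at e1
  have e2 := congrArg (starRingEnd ℂ) e1
  rw [map_mul, sesqForm_conj h.inFace.symm, sesqForm_conj h.inFace.symm] at e2
  -- For g = (X − ω)q, the relation ⟨g, q⟩ = ω̄⟨g, Xq⟩ gives ⟨g, g⟩ = (1 − ωω̄)⟨g, Xq⟩ = 0.
  have e3 : sesqForm A (cyc n g) (cyc n g) = 0 := by
    conv_lhs => rw [hgq]
    conv_lhs => arg 3; rw [cyc_linear_mul]
    rw [← hgq, sesqForm_sub, sesqForm_smul, e2]
    linear_combination (-sesqForm A (cyc n g) (shifted (cyc n q) 1)) * hω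
  obtain ⟨h1, h2⟩ := h.of_isotropic hg e3
  rw [hgq, cyc_linear_mul, h1, map_sub, map_smul, cMulVec_shifted h.circ] at h2
  set v := cMulVec A (cyc n q)
  -- Now ω = −1, so A g = (S + 1)v has vanishing alternating sum, unlike α e_{−2}.
  have h3 : ∑ i, (altSign i : ℂ) * (shifted v 1 i - (-1 : ℂ) * v i) = 0 := by
    have h4 : ∑ i, (altSign i : ℂ) * shifted v 1 i = -∑ i, (altSign i : ℂ) * v i := by
      rw [← Equiv.sum_comp (Equiv.addRight 1), ← Finset.sum_neg_distrib]
      refine Finset.sum_congr rfl fun i _ => ?_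
      simp only [Equiv.coe_addRight, shifted, add_sub_cancel_right, altSign_add_one h.even]
      push_cast
      ring
    simp only [mul_sub, Finset.sum_sub_distrib, h4]
    rw [← Finset.sum_neg_distrib, ← Finset.sum_sub_distrib]
    exact Finset.sum_eq_zero fun i _ => by ring
  have h5 : ∑ i, (altSign i : ℂ) * ((α : ℂ) • Pi.single (M := fun _ => ℂ) (-2 : ZMod n) 1) i = 0 := by
    rw [← h2, ← h3]
    rfl
  rw [Finset.sum_eq_single (-2)] at h5
  · have hα : (α : ℂ) ≠ 0 := Complex.ofReal_ne_zero.2 h.pos.ne'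
    have hs : (altSign (-2 : ZMod n) : ℂ) ≠ 0 := by
      rcases altSign_eq_or (-2 : ZMod n) with h | h <;> rw [h] <;> simp
    simp [hα, hs] at h5
  · intro i _ hi
    simp [hi]
  · simp

/-- The only `n`-th root of unity among the roots is `-1`. -/
theorem IsCircWitness.root_pow_ne_one (h : IsCircWitness p f A α)
    (hg : p.map (algebraMap ℝ ℂ) = (X - C ω) * g) (hω : ω ≠ -1) : ω ^ n ≠ 1 := by
  intro hωn
  have hω0 : ω ≠ 0 := by
    rintro rfl
    rw [zero_pow (NeZero.ne n)] at hωn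
    exact zero_ne_one hωn
  set v : ZMod n → ℂ := fun i => ω ^ i.val with hv
  have hvs : ∀ i, v (i + 1) = ω * v i := by
    intro i
    obtain ⟨k, rfl⟩ : ∃ k : ℕ, (k : ZMod n) = i := ⟨i.val, ZMod.natCast_zmod_val i⟩
    have hk : ∀ k : ℕ, v (k : ZMod n) = ω ^ k := fun k => by
      simp only [hv, ZMod.val_natCast]
      conv_rhs => rw [← Nat.mod_add_div k n, pow_add, pow_mul, hωn, one_pow, mul_one]
    rw [← Nat.cast_succ, hk, hk, pow_succ']
  have h1 := h.cMulVec_cyc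
  rw [hg, cyc_linear_mul, map_sub, map_smul, cMulVec_shifted h.circ] at h1
  set u := cMulVec A (cyc n g)
  -- The character i ↦ ω^i annihilates the range of S − ω, but its sum against α(e_{−2} + e_{−1}) is
  -- α v(−2)(1 + ω).
  have h2 : ∑ i, v i * (shifted u 1 - ω • u) i = 0 := by
    have h3 : ∑ i, v i * shifted u 1 i = ω * ∑ i, v i * u i := by
      rw [← Equiv.sum_comp (Equiv.addRight 1), Finset.mul_sum]
      refine Finset.sum_congr rfl fun i _ => ?_
      simp only [Equiv.coe_addRight, shifted, add_sub_cancel_right, hvs]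
      ring
    simp only [Pi.sub_apply, mul_sub, Finset.sum_sub_distrib, h3, Pi.smul_apply, smul_eq_mul,
      Finset.mul_sum]
    rw [← Finset.sum_sub_distrib]
    exact Finset.sum_eq_zero fun i _ => by ring
  rw [h1] at h2
  have h4 : ∑ i, v i * ((α : ℂ) • (Pi.single (-2) 1 + Pi.single (-1) 1 : ZMod n → ℂ)) i =
      α * (v (-2) + v (-1)) := by
    simp only [Pi.smul_apply, Pi.add_apply, smul_eq_mul, Pi.single_apply, mul_add, mul_ite, mul_one,
      mul_zero, Finset.sum_add_distrib, Finset.sum_ite_eq', Finset.mem_univ, if_true]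
    ring
  rw [h4, show (-1 : ZMod n) = -2 + 1 by ring, hvs] at h2
  have hα : (α : ℂ) ≠ 0 := Complex.ofReal_ne_zero.2 h.pos.ne'
  have h5 : v (-2) ≠ 0 := pow_ne_zero _ hω0
  have h6 : (α * v (-2)) * (1 + ω) = 0 := by linear_combination h2
  rcases mul_eq_zero.1 h6 with h7 | h7
  · exact mul_ne_zero hα h5 h7
  · exact hω (by linear_combination h7)

end LinearFactor

end Roots

/-! ### Coprimality of the factors -/

section Coprime

theorem isCoprime_quadFactor_quadFactor {θ η : ℝ} (h : Real.cos θ ≠ Real.cos η) :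
    IsCoprime (quadFactor θ) (quadFactor η) := by
  have h0 : 2 * (Real.cos η - Real.cos θ) ≠ 0 := mul_ne_zero two_ne_zero (sub_ne_zero.2 h.symm)
  set c := 2 * (Real.cos η - Real.cos θ) with hc
  have h1 : (C c⁻¹ * (C (2 * Real.cos η) - C (2 * Real.cos θ)) : ℝ[X]) = 1 := by
    rw [← C_sub, ← C_mul, ← mul_sub, ← hc, inv_mul_cancel₀ h0, C_1]
  -- The difference of the two factors is cX, and `quadFactor θ` is X(X − 2 cos θ) + 1; eliminating
  -- X yields these coefficients.
  refine ⟨1 - C c⁻¹ * (X - C (2 * Real.cos θ)), C c⁻¹ * (X - C (2 * Real.cos θ)), ?_⟩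
  simp only [quadFactor]
  linear_combination (-X * (X - C (2 * Real.cos θ))) * h1

theorem isCoprime_X_add_one_quadFactor {θ : ℝ} (h : θ ∈ Set.Ioo 0 Real.pi) :
    IsCoprime (X + 1) (quadFactor θ) := by
  have h0 : 2 * (1 + Real.cos θ) ≠ 0 := mul_ne_zero two_ne_zero (one_add_cos_pos h).ne'
  set c := 2 * (1 + Real.cos θ) with hc
  have h1 : (C c⁻¹ * (2 + C (2 * Real.cos θ)) : ℝ[X]) = 1 := by
    rw [show (2 : ℝ[X]) = C 2 from rfl, ← C_add, ← C_mul,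
      show 2 + 2 * Real.cos θ = c by rw [hc]; ring, inv_mul_cancel₀ h0, C_1]
  refine ⟨-C c⁻¹ * (X - 1 - C (2 * Real.cos θ)), C c⁻¹, ?_⟩
  simp only [quadFactor]
  linear_combination h1

end Coprime

/-! ### From roots to angles -/

section Angles

variable {n : ℕ} [NeZero n] {f : ZMod n → ℝ} {A : Matrix (ZMod n) (ZMod n) ℝ} {α : ℝ} {p : ℝ[X]}

theorem IsCircWitness.leadingCoeff_pos (h : IsCircWitness p f A α) : 0 < p.leadingCoeff := by
  have hd := h.natDegree
  have h3 : ((p.natDegree : ℕ) : ZMod n) = -3 - 0 := by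
    have : ((p.natDegree + 3 : ℕ) : ZMod n) = 0 := by rw [hd, ZMod.natCast_self]
    push_cast at this
    linear_combination this
  have h4 := h.coeff (p.natDegree : ZMod n)
  rw [ZMod.val_natCast, Nat.mod_eq_of_lt (by omega), h3, h.profile.symm] at h4
  rw [leadingCoeff, ← h4]
  exact h.profile.zero_pos h.five_lt

theorem IsCircWitness.map_ne_zero (h : IsCircWitness p f A α) : p.map (algebraMap ℝ ℂ) ≠ 0 := by
  rw [Ne, Polynomial.map_eq_zero]
  rintro rfl
  have := h.leadingCoeff_pos
  simp at this

theorem IsCircWitness.nodup_roots (h : IsCircWitness p f A α) :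
    (p.map (algebraMap ℝ ℂ)).roots.Nodup := by
  rw [Multiset.nodup_iff_count_le_one]
  intro ω
  rw [count_roots]
  by_contra! hlt
  obtain ⟨q, hq⟩ := (le_rootMultiplicity_iff h.map_ne_zero).1 (Nat.succ_le_of_lt hlt)
  exact h.not_double_root (ω := ω) (q := q) (by rw [hq]; ring)

theorem IsCircWitness.card_roots (h : IsCircWitness p f A α) :
    (p.map (algebraMap ℝ ℂ)).roots.toFinset.card + 3 = n := by
  rw [Multiset.toFinset_card_of_nodup h.nodup_roots,
    ← (IsAlgClosed.splits (p.map (algebraMap ℝ ℂ))).natDegree_eq_card_roots, natDegree_map,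
    h.natDegree]

theorem IsCircWitness.mem_roots (h : IsCircWitness p f A α) {z : ℂ} :
    z ∈ (p.map (algebraMap ℝ ℂ)).roots.toFinset ↔ aeval z p = 0 := by
  rw [Multiset.mem_toFinset, Polynomial.mem_roots h.map_ne_zero, IsRoot.def, eval_map, aeval_def]

theorem IsCircWitness.eval_neg_one (h : IsCircWitness p f A α) : p.eval (-1) = 0 := by
  have hd := h.natDegree
  rw [← sum_altSign_mul_coeff (n := n) (by omega)]
  have h1 := congrFun (altMat_mulVec_shifted h.even h.profile 0) 0
  rw [altMat_mulVec, altSign_zero, one_mul] at h1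
  simpa [shifted, h.coeff] using h1

theorem IsCircWitness.eval_one (h : IsCircWitness p f A α) : p.eval 1 ≠ 0 := by
  have hd := h.natDegree
  rw [eval_eq_sum_range' (n := n) (by omega), sum_range_eq_sum_zmod]
  simp only [one_pow, mul_one, ← h.coeff]
  exact (Finset.sum_pos' (fun d _ => h.profile.nonneg d) ⟨0, Finset.mem_univ _, h.profile.zero_pos h.five_lt⟩).ne'

theorem exists_cofactor_of_root {z : ℂ} (hz : aeval z p = 0) :
    ∃ g, p.map (algebraMap ℝ ℂ) = (X - C z) * g :=
  dvd_iff_isRoot.2 (by rwa [IsRoot.def, eval_map, ← aeval_def])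

theorem IsCircWitness.norm_root (h : IsCircWitness p f A α) {z : ℂ} (hz : aeval z p = 0) :
    ‖z‖ = 1 := by
  obtain ⟨g, hg⟩ := exists_cofactor_of_root hz
  have h1 := h.mul_conj_root hg
  rw [Complex.mul_conj, Complex.normSq_eq_norm_sq] at h1
  have h2 : ‖z‖ ^ 2 = 1 := by exact_mod_cast h1
  exact (pow_eq_one_iff_of_nonneg (norm_nonneg z) two_ne_zero).1 h2

theorem aeval_conj_eq_zero {z : ℂ} (hz : aeval z p = 0) : aeval (starRingEnd ℂ z) p = 0 := by
  rw [aeval_conj, hz, map_zero]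

/-- The roots in the upper half-plane. -/
noncomputable def upperRoots (p : ℝ[X]) : Finset ℂ :=
  (p.map (algebraMap ℝ ℂ)).roots.toFinset.filter fun z => 0 < z.im

/-- The roots are unimodular and stable under conjugation. A real one is ±1, and 1 is excluded
because the coefficients are nonnegative with positive sum. -/
theorem IsCircWitness.roots_eq (h : IsCircWitness p f A α) :
    (p.map (algebraMap ℝ ℂ)).roots.toFinset =
      insert (-1) (upperRoots p ∪ (upperRoots p).image (starRingEnd ℂ)) := by
  ext z
  simp only [upperRoots, Finset.mem_insert, Finset.mem_union, Finset.mem_image, Finset.mem_filter,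
    h.mem_roots]
  constructor
  · intro hz
    rcases lt_trichotomy z.im 0 with hi | hi | hi
    · exact Or.inr (Or.inr ⟨starRingEnd ℂ z, ⟨aeval_conj_eq_zero hz, by simpa using hi⟩, by simp⟩)
    · left
      have hzr : z = (z.re : ℂ) := Complex.ext rfl (by simpa using hi)
      have hn := h.norm_root hz
      rw [hzr, Complex.norm_real, Real.norm_eq_abs] at hn
      rcases eq_or_eq_neg_of_abs_eq hn with h1 | h1
      · exfalso
        rw [hzr, h1] at hz
        apply h.eval_one
        have h2 := aeval_algebraMap_apply ℂ (1 : ℝ) p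
        rw [Complex.coe_algebraMap, hz, eq_comm, Complex.ofReal_eq_zero] at h2
        simpa [aeval_def] using h2
      · rw [hzr, h1]; simp
    · exact Or.inr (Or.inl ⟨hz, hi⟩)
  · rintro (rfl | ⟨hz, -⟩ | ⟨w, ⟨hw, -⟩, rfl⟩)
    · have h2 := aeval_algebraMap_apply ℂ (-1 : ℝ) p
      rw [coe_aeval_eq_eval, h.eval_neg_one, map_zero] at h2
      simpa using h2
    · exact hz
    · exact aeval_conj_eq_zero hw

theorem IsCircWitness.card_upperRoots (h : IsCircWitness p f A α) :
    2 * (upperRoots p).card + 4 = n := by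
  have h1 := h.card_roots
  rw [h.roots_eq, Finset.card_insert_of_notMem, Finset.card_union_of_disjoint,
    Finset.card_image_of_injective _ (RingHom.injective _)] at h1
  · omega
  · rw [Finset.disjoint_left]
    intro z hz hz'
    obtain ⟨w, hw, rfl⟩ := Finset.mem_image.1 hz'
    have h2 := (Finset.mem_filter.1 hz).2
    have h3 := (Finset.mem_filter.1 hw).2
    rw [Complex.conj_im] at h2
    linarith
  · intro hm
    rcases Finset.mem_union.1 hm with hz | hz
    · have h2 := (Finset.mem_filter.1 hz).2
      simp at h2
    · obtain ⟨w, hw, hw'⟩ := Finset.mem_image.1 hz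
      have h3 := (Finset.mem_filter.1 hw).2
      have := congrArg Complex.im hw'
      simp at this
      linarith

theorem exp_arg_of_norm_one {z : ℂ} (hz : ‖z‖ = 1) : Complex.exp (z.arg * Complex.I) = z := by
  have := Complex.norm_mul_exp_arg_mul_I z
  rwa [hz, Complex.ofReal_one, one_mul] at this

theorem arg_mem_Ioo_of_im_pos {z : ℂ} (hz : ‖z‖ = 1) (hi : 0 < z.im) :
    z.arg ∈ Set.Ioo 0 Real.pi := by
  have h1 : z.im = Real.sin z.arg := by
    conv_lhs => rw [← exp_arg_of_norm_one hz]
    exact Complex.exp_ofReal_mul_I_im _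
  rw [h1] at hi
  constructor
  · by_contra! hle
    exact hi.not_ge (Real.sin_nonpos_of_nonpos_of_neg_pi_le hle (Complex.neg_pi_lt_arg z).le)
  · refine (Complex.arg_le_pi z).lt_of_ne fun h => ?_
    rw [h, Real.sin_pi] at hi
    exact hi.false

/-- The factorization of the polynomial of the profile. -/
theorem IsCircWitness.exists_angles (h : IsCircWitness p f A α) {m : ℕ} (hnm : n = 2 * m + 4) :
    ∃ ζ : Fin m → ℝ, StrictMono ζ ∧ IsFactored p ζ f := by
  have hroot : ∀ z ∈ upperRoots p, aeval z p = 0 ∧ 0 < z.im := fun z hz =>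
    ⟨h.mem_roots.1 (Finset.mem_filter.1 hz).1, (Finset.mem_filter.1 hz).2⟩
  have hcard : ((upperRoots p).image Complex.arg).card = m := by
    rw [Finset.card_image_of_injOn]
    · have := h.card_upperRoots
      omega
    · intro z hz w hw hzw
      rw [← exp_arg_of_norm_one (h.norm_root (hroot z hz).1),
        ← exp_arg_of_norm_one (h.norm_root (hroot w hw).1)]
      exact congrArg (fun t : ℝ => Complex.exp (t * Complex.I)) hzw
  set ζ : Fin m → ℝ := fun j => ((upperRoots p).image Complex.arg).orderEmbOfFin hcard j with hζ
  have hmono : StrictMono ζ := (((upperRoots p).image Complex.arg).orderEmbOfFin hcard).strictMono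
  have hmem : ∀ j, ζ j ∈ Set.Ioo 0 Real.pi ∧ aeval (Complex.exp (ζ j * Complex.I)) p = 0 := by
    intro j
    have h1 := Finset.orderEmbOfFin_mem ((upperRoots p).image Complex.arg) hcard j
    obtain ⟨z, hz, hz'⟩ := Finset.mem_image.1 h1
    obtain ⟨h2, h3⟩ := hroot z hz
    have h4 := h.norm_root h2
    simp only [hζ]
    rw [← hz', exp_arg_of_norm_one h4]
    exact ⟨arg_mem_Ioo_of_im_pos h4 h3, h2⟩
  have hsinpos : ∀ j, 0 < Real.sin (ζ j) := fun j => Real.sin_pos_of_mem_Ioo (hmem j).1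
  have hdvd : ∀ j, quadFactor (ζ j) ∣ p := by
    intro j
    have h1 := quadratic_dvd_of_aeval_eq_zero_im_ne_zero p (hmem j).2
      (by rw [Complex.exp_ofReal_mul_I_im]; exact (hsinpos j).ne')
    rwa [Complex.exp_ofReal_mul_I_re, Complex.norm_exp_ofReal_mul_I, one_pow, C_1] at h1
  have hcos := injective_cos_comp hmono.injective fun j => (hmem j).1
  -- Pairwise coprime divisors of p; their product has degree 2m + 1 = n − 3, so the quotient is
  -- constant.
  have hD : (X + 1) * ∏ j, quadFactor (ζ j) ∣ p := by
    refine IsCoprime.mul_dvd (IsCoprime.prod_right fun j _ =>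
      isCoprime_X_add_one_quadFactor (hmem j).1) ?_ ?_
    · have := dvd_iff_isRoot.2 h.eval_neg_one
      rwa [C_neg, C_1, sub_neg_eq_add] at this
    · refine Finset.prod_dvd_of_coprime (fun i _ j _ hij =>
        isCoprime_quadFactor_quadFactor (hcos.ne hij)) fun j _ => hdvd j
  obtain ⟨q, hq⟩ := hD
  have hDm : ((X + 1) * ∏ j, quadFactor (ζ j)).Monic := by
    rw [← C_1]
    exact (monic_X_add_C 1).mul (monic_prod_of_monic _ _ fun j _ => quadFactor_monic _)
  have hq0 : q ≠ 0 := by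
    rintro rfl
    have := h.leadingCoeff_pos
    rw [hq] at this
    simp at this
  have hqd : q.natDegree = 0 := by
    have h1 := congrArg Polynomial.natDegree hq
    rw [hDm.natDegree_mul' hq0, natDegree_X_add_one_mul_prod, Finset.card_univ,
      Fintype.card_fin] at h1
    have := h.natDegree
    omega
  rw [eq_C_of_natDegree_eq_zero hqd] at hq
  refine ⟨ζ, hmono, hnm, ?_, hmono.injective, fun j => (hmem j).1, fun j hs => ?_, h.coeff,
    q.coeff 0, ?_, by rw [mul_comm]; exact hq⟩
  · have := h.five_lt
    omega
  -- A zero of sin(nζ/2) would make exp(iζ) an n-th root of unity other than −1.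
  · obtain ⟨g, hg⟩ := exists_cofactor_of_root (hmem j).2
    refine h.root_pow_ne_one hg (fun h1 => exp_add_one_ne_zero (hmem j).1 (by rw [h1]; ring)) ?_
    obtain ⟨k, hk⟩ := Real.sin_eq_zero_iff.1 hs
    rw [← Complex.exp_nat_mul, Complex.exp_eq_one_iff]
    refine ⟨k, ?_⟩
    have h2 : (n : ℂ) * ζ j = k * (2 * Real.pi) := by
      have : (n : ℝ) * ζ j = k * (2 * Real.pi) := by linarith
      exact_mod_cast this
    linear_combination Complex.I * h2
  · have := h.leadingCoeff_pos
    rwa [hq, leadingCoeff_mul, hDm.leadingCoeff, leadingCoeff_C, one_mul] at this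

end Angles

/-! ### The parity condition and the signs of the weights -/

section Signs

variable {n m : ℕ}

theorem sin_two_pi_mul_fract (x : ℝ) :
    Real.sin (2 * Real.pi * Int.fract x) = Real.sin (2 * Real.pi * x) := by
  conv_rhs => rw [← Int.fract_add_floor x, mul_add, mul_comm (2 * Real.pi) (⌊x⌋ : ℝ),
    Real.sin_add_int_mul_two_pi]

theorem sin_two_pi_mul_pos_iff (x : ℝ) :
    0 < Real.sin (2 * Real.pi * x) ↔ Int.fract x ∈ Set.Ioo (0 : ℝ) (1 / 2) := by
  rw [← sin_two_pi_mul_fract]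
  have h0 := Int.fract_nonneg x
  have h1 := Int.fract_lt_one x
  generalize Int.fract x = t at *
  have hpi := Real.pi_pos
  constructor
  · intro h
    refine ⟨h0.lt_of_ne ?_, ?_⟩
    · rintro rfl
      simp at h
    · by_contra! ht
      have : 0 ≤ Real.sin (2 * Real.pi * t - Real.pi) :=
        Real.sin_nonneg_of_nonneg_of_le_pi (by nlinarith) (by nlinarith)
      rw [Real.sin_sub_pi] at this
      linarith
  · rintro ⟨h2, h3⟩
    exact Real.sin_pos_of_pos_of_lt_pi (by positivity) (by nlinarith)

theorem sin_two_pi_mul_neg_iff (x : ℝ) :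
    Real.sin (2 * Real.pi * x) < 0 ↔ Int.fract x ∈ Set.Ioo (1 / 2 : ℝ) 1 := by
  rw [← sin_two_pi_mul_fract]
  have h0 := Int.fract_nonneg x
  have h1 := Int.fract_lt_one x
  generalize Int.fract x = t at *
  have hpi := Real.pi_pos
  constructor
  · intro h
    refine ⟨?_, h1⟩
    by_contra! ht
    have : 0 ≤ Real.sin (2 * Real.pi * t) :=
      Real.sin_nonneg_of_nonneg_of_le_pi (by positivity) (by nlinarith)
    linarith
  · rintro ⟨h2, h3⟩
    have : 0 < Real.sin (2 * Real.pi * t - Real.pi) :=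
      Real.sin_pos_of_pos_of_lt_pi (by nlinarith) (by nlinarith)
    rw [Real.sin_sub_pi] at this
    linarith

/-- nθ/2 is 2π times nθ/(4π), and the sign of sin(2πx) depends on which half of the unit interval
contains the fractional part of x. -/
theorem parity_iff (θ : ℝ) (j : ℕ) :
    ((Even j → Int.fract (n * θ / (4 * Real.pi)) ∈ Set.Ioo (0 : ℝ) (1 / 2)) ∧
      (Odd j → Int.fract (n * θ / (4 * Real.pi)) ∈ Set.Ioo (1 / 2 : ℝ) 1)) ↔
    0 < (-1) ^ j * Real.sin (n * θ / 2) := by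
  have hx : n * θ / 2 = 2 * Real.pi * (n * θ / (4 * Real.pi)) := by
    have := Real.pi_ne_zero
    field_simp
    norm_num
  rw [← sin_two_pi_mul_pos_iff, ← sin_two_pi_mul_neg_iff, ← hx]
  rcases Nat.even_or_odd j with h | h
  · simp [h, h.neg_one_pow]
  · simp [h, h.neg_one_pow]

/-- The cosine decreases on (0, π), so the negative factors are those with l < j, and there are j of
them since indices start at 0. -/
theorem prod_cos_sub_cos_sign {ζ : Fin m → ℝ} (hmono : StrictMono ζ)
    (hζ : ∀ j, ζ j ∈ Set.Ioo 0 Real.pi) (j : Fin m) :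
    0 < (-1) ^ (j : ℕ) * ∏ l ∈ Finset.univ.erase j, (Real.cos (ζ j) - Real.cos (ζ l)) := by
  have hs : Finset.univ.erase j = Finset.Iio j ∪ Finset.Ioi j := by
    ext l
    simp [lt_or_lt_iff_ne]
  have hd : Disjoint (Finset.Iio j) (Finset.Ioi j) := by
    rw [Finset.disjoint_left]
    intro l h1 h2
    exact (Finset.mem_Iio.1 h1).asymm (Finset.mem_Ioi.1 h2)
  have hanti : ∀ i l, i < l → Real.cos (ζ l) < Real.cos (ζ i) := fun i l hil =>
    Real.strictAntiOn_cos ⟨(hζ i).1.le, (hζ i).2.le⟩ ⟨(hζ l).1.le, (hζ l).2.le⟩ (hmono hil)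
  rw [hs, Finset.prod_union hd, ← mul_assoc]
  conv in (-1) ^ (j : ℕ) => rw [← Fin.card_Iio j]
  rw [← Finset.prod_const, ← Finset.prod_mul_distrib]
  refine mul_pos (Finset.prod_pos fun l hl => ?_) (Finset.prod_pos fun l hl => ?_)
  · linarith [hanti l j (Finset.mem_Iio.1 hl)]
  · linarith [hanti j l (Finset.mem_Ioi.1 hl)]

theorem fundWeight_pos_iff {ζ : Fin m → ℝ} (hmono : StrictMono ζ)
    (hζ : ∀ j, ζ j ∈ Set.Ioo 0 Real.pi) (j : Fin m) :
    0 < fundWeight n ζ j ↔ 0 < (-1) ^ (j : ℕ) * Real.sin (n * ζ j / 2) := by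
  have h1 := Real.sin_pos_of_mem_Ioo (hζ j)
  have h2 := prod_cos_sub_cos_sign hmono hζ j
  have h3 : ((-1 : ℝ) ^ (j : ℕ)) * (-1) ^ (j : ℕ) = 1 := by rw [← mul_pow]; simp
  rw [fundWeight, inv_pos]
  set Q := ∏ l ∈ Finset.univ.erase j, (Real.cos (ζ j) - Real.cos (ζ l))
  have h4 : Real.sin (ζ j) * Real.sin (n * ζ j / 2) * Q =
      Real.sin (ζ j) * ((-1) ^ (j : ℕ) * Q) * ((-1) ^ (j : ℕ) * Real.sin (n * ζ j / 2)) := by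
    linear_combination (-(Real.sin (ζ j) * Real.sin (n * ζ j / 2) * Q)) * h3
  rw [h4]
  exact mul_pos_iff_of_pos_left (mul_pos h1 h2)

end Signs

/-! ### The face as a two-dimensional cone -/

section Cone

variable {n m : ℕ} {p : ℝ[X]} {ζ : Fin m → ℝ} {f : ZMod n → ℝ} {A : Matrix (ZMod n) (ZMod n) ℝ}

theorem altMat_zero_zero : altMat n 0 0 = 1 := by simp [altMat, altSign_zero]

theorem IsFactored.fundMat_zero_zero_pos (h : IsFactored p ζ f)
    (hw : ∀ j, 0 < fundWeight n ζ j) : 0 < fundMat n ζ 0 0 := by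
  simp only [fundMat, circMat, Matrix.of_apply, sub_self, ZMod.valMinAbs_zero, trigSeq,
    Int.cast_zero, zero_mul, Real.cos_zero, mul_one]
  exact Finset.sum_pos (fun j _ => hw j) ⟨⟨0, h.m_pos⟩, Finset.mem_univ _⟩

theorem rowFormula_eq (k : ℕ) (c lam : ℝ) :
    rowFormula n ζ c lam k = c * trigSeq (fundWeight n ζ) ζ k + (-1) ^ k * lam := by
  rw [rowFormula, add_comm, trigSeq]
  congr 2
  refine Finset.sum_congr rfl fun j _ => ?_
  rw [fundWeight, div_eq_mul_inv, mul_comm, Int.cast_natCast]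

variable [NeZero n]

theorem IsFactored.inFace_iff (h : IsFactored p ζ f) (hf : IsZeroProfile f)
    (hw : ∀ j, 0 < fundWeight n ζ j) :
    InFace f A ↔ ∃ c lam : ℝ, 0 ≤ c ∧ 0 ≤ lam ∧ A = c • fundMat n ζ + lam • altMat n := by
  constructor
  · intro hA
    obtain ⟨α, hα0, hα⟩ := hA.exists_const h.five_lt h.even hf
    obtain ⟨γ, lam, hγ, rfl⟩ := h.exists_decomposition hf hA.symm hα
    exact ⟨α / γ, lam, by positivity, h.lam_nonneg hf hA, rfl⟩
  · rintro ⟨c, lam, hc, hlam, rfl⟩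
    exact h.inFace_of_weight_pos hf hw hc hlam

theorem IsFactored.annihilates_iff (h : IsFactored p ζ f) (hf : IsZeroProfile f)
    (c lam : ℝ) : (∀ j, (c • fundMat n ζ + lam • altMat n).mulVec (shifted f j) = 0) ↔ c = 0 := by
  obtain ⟨γ, hγ, hγ'⟩ := h.exists_gap hf
  constructor
  · intro h0
    have h1 := congrArg (fun v => (fun _ => 1 : ZMod n → ℝ) ⬝ᵥ v) (h0 0)
    simp only [Matrix.add_mulVec, Matrix.smul_mulVec, dotProduct_add, dotProduct_smul, hγ',
      altMat_mulVec_shifted h.even hf, dotProduct_zero, smul_eq_mul, mul_zero, add_zero] at h1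
    refine (mul_eq_zero.1 h1).resolve_right ?_
    positivity
  · rintro rfl j
    rw [zero_smul, zero_add, Matrix.smul_mulVec, altMat_mulVec_shifted h.even hf, smul_zero]

theorem IsFactored.eq_zero_of_combination (h : IsFactored p ζ f) (hf : IsZeroProfile f) {c lam : ℝ}
    (h0 : c • fundMat n ζ + lam • altMat n = 0) : c = 0 ∧ lam = 0 := by
  have hc := (h.annihilates_iff hf c lam).1 fun j => by rw [h0, Matrix.zero_mulVec]
  refine ⟨hc, ?_⟩
  have := congrFun (congrFun h0 0) 0
  simpa [hc, altMat_zero_zero] using this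

/-- The summands in a decomposition of a matrix in the face into copositive matrices are in the
face. -/
theorem InFace.of_add {B C : Matrix (ZMod n) (ZMod n) ℝ} (hA : InFace f (B + C))
    (hf : IsZeroProfile f) (hB : B.IsSymm)
    (hBc : ∀ x : ZMod n → ℝ, (∀ i, 0 ≤ x i) → 0 ≤ x ⬝ᵥ B.mulVec x)
    (hCc : ∀ x : ZMod n → ℝ, (∀ i, 0 ≤ x i) → 0 ≤ x ⬝ᵥ C.mulVec x) : InFace f B where
  symm := hB
  cop := hBc
  zero j := by
    have h1 := hBc (shifted f j) fun _ => hf.nonneg _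
    have h2 := hCc (shifted f j) fun _ => hf.nonneg _
    have h3 := hA.zero j
    rw [Matrix.add_mulVec, dotProduct_add] at h3
    linarith

/-- Both summands lie in the face, so both have nonnegative coefficients of `altMat n`. These add up
to zero, hence vanish. -/
theorem IsFactored.extremal (h : IsFactored p ζ f) (hf : IsZeroProfile f)
    (hw : ∀ j, 0 < fundWeight n ζ j) {B C : Matrix (ZMod n) (ZMod n) ℝ} (hB : B.IsSymm)
    (hBc : ∀ x : ZMod n → ℝ, (∀ i, 0 ≤ x i) → 0 ≤ x ⬝ᵥ B.mulVec x) (hC : C.IsSymm)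
    (hCc : ∀ x : ZMod n → ℝ, (∀ i, 0 ≤ x i) → 0 ≤ x ⬝ᵥ C.mulVec x)
    (hsum : fundMat n ζ = B + C) : ∃ β : ℝ, 0 ≤ β ∧ B = β • fundMat n ζ := by
  have hA : InFace f (B + C) := by
    rw [← hsum]
    exact (h.inFace_iff hf hw).2 ⟨1, 0, zero_le_one, le_rfl, by simp⟩
  obtain ⟨c, lam, hc, hlam, hBeq⟩ := (h.inFace_iff hf hw).1 (hA.of_add hf hB hBc hCc)
  rw [add_comm] at hA
  have hCf := hA.of_add hf hC hCc hBc
  have hCeq : C = (1 - c) • fundMat n ζ + (-lam) • altMat n := by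
    have : C = fundMat n ζ - B := by rw [hsum]; abel
    rw [this, hBeq, sub_smul, one_smul, neg_smul]
    abel
  rw [hCeq] at hCf
  have h0 : lam = 0 := le_antisymm (by linarith [h.lam_nonneg hf hCf]) hlam
  exact ⟨c, hc, by rw [hBeq, h0, zero_smul, add_zero]⟩

/-- The semi-definite part kills the zeros, so it is a nonnegative multiple of `altMat n`; the sign
condition on the other part makes this multiple zero. A nonnegative matrix with zero u^0 has
vanishing (0, 0) entry, but that entry of `fundMat n ζ` is the sum of the weights. -/
theorem IsFactored.not_psd_add_nonneg (h : IsFactored p ζ f) (hf : IsZeroProfile f)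
    (hw : ∀ j, 0 < fundWeight n ζ j) {B C : Matrix (ZMod n) (ZMod n) ℝ} (hB : B.IsSymm)
    (hBc : ∀ x : ZMod n → ℝ, 0 ≤ x ⬝ᵥ B.mulVec x) (hC : C.IsSymm) (hC0 : ∀ i j, 0 ≤ C i j)
    (hsum : fundMat n ζ = B + C) : False := by
  have hA : InFace f (B + C) := by
    rw [← hsum]
    exact (h.inFace_iff hf hw).2 ⟨1, 0, zero_le_one, le_rfl, by simp⟩
  have hCc : ∀ x : ZMod n → ℝ, (∀ i, 0 ≤ x i) → 0 ≤ x ⬝ᵥ C.mulVec x := fun x hx =>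
    Finset.sum_nonneg fun i _ => mul_nonneg (hx i) (Finset.sum_nonneg fun j _ =>
      mul_nonneg (hC0 i j) (hx j))
  have hBf := hA.of_add hf hB (fun x _ => hBc x) hCc
  have hB0 : ∀ j, B.mulVec (shifted f j) = 0 := fun j => funext fun i =>
    mulVec_eq_zero_of_quadForm_eq_zero hB (S := Set.univ) (fun x _ => hBc x) (by simp)
      (hBf.zero j) (Set.mem_univ i)
  have hBeq := h.eq_smul_altMat hB hB0
  have hB00 : 0 ≤ B 0 0 := by
    have := hBc (Pi.single 0 1)
    rwa [single_one_dotProduct, Matrix.mulVec_single_one] at this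
  rw [add_comm] at hA
  have hCf := hA.of_add hf hC hCc fun x _ => hBc x
  have hCeq : C = (1 : ℝ) • fundMat n ζ + (-B 0 0) • altMat n := by
    rw [one_smul, neg_smul, ← hBeq, hsum]
    abel
  have h0 : B 0 0 = 0 := le_antisymm (by
    have := hCf
    rw [hCeq] at this
    linarith [h.lam_nonneg hf this]) hB00
  have hC00 : C 0 0 = 0 := by
    have h1 := hCf.zero 0
    have hz : 0 < shifted f 0 (0 : ZMod n) := by simpa [shifted] using hf.zero_pos h.five_lt
    have hnn : ∀ i, 0 ≤ shifted f 0 i := fun _ => hf.nonneg _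
    have h2 := (Finset.sum_eq_zero_iff_of_nonneg fun i _ => mul_nonneg (hnn i)
      (Finset.sum_nonneg fun j _ => mul_nonneg (hC0 i j) (hnn j))).1 h1 0 (Finset.mem_univ _)
    have h3 := (mul_eq_zero.1 h2).resolve_left hz.ne'
    have h4 := (Finset.sum_eq_zero_iff_of_nonneg fun j _ => mul_nonneg (hC0 0 j) (hnn j)).1 h3 0
      (Finset.mem_univ _)
    exact (mul_eq_zero.1 h4).resolve_right hz.ne'
  have h5 := congrFun (congrFun hsum 0) 0
  rw [Matrix.add_apply, h0, hC00, add_zero] at h5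
  exact (h.fundMat_zero_zero_pos hw).ne' h5

/-- In a symmetric circulant matrix the entries d and −d of the first row agree, so half of the row
suffices. -/
theorem eq_of_circulant_of_row {B B' : Matrix (ZMod n) (ZMod n) ℝ} (hB : B.IsSymm)
    (hB' : B'.IsSymm) (hc : ∀ i j k, B (i + k) (j + k) = B i j)
    (hc' : ∀ i j k, B' (i + k) (j + k) = B' i j)
    (hrow : ∀ k : ZMod n, k.val ≤ n / 2 → B 0 k = B' 0 k) : B = B' := by
  have hrow' : ∀ d, B 0 d = B' 0 d := by
    intro d
    by_cases hd : d.val ≤ n / 2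
    · exact hrow d hd
    · have hd0 : d ≠ 0 := by
        rintro rfl
        simp at hd
      have : NeZero d := ⟨hd0⟩
      have hneg : ∀ C : Matrix (ZMod n) (ZMod n) ℝ, C.IsSymm →
          (∀ i j k, C (i + k) (j + k) = C i j) → C 0 d = C 0 (-d) := by
        intro C hC hCc
        rw [← hCc 0 d (-d), zero_add, add_neg_cancel, hC.apply]
      rw [hneg B hB hc, hneg B' hB' hc']
      refine hrow _ ?_
      rw [ZMod.val_neg_of_ne_zero]
      omega
  ext i j
  have := hc 0 (j - i) i
  have h' := hc' 0 (j - i) i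
  rw [zero_add, sub_add_cancel] at this h'
  rw [this, h', hrow']

theorem combination_row (c lam : ℝ) {k : ZMod n} (hk : k.val ≤ n / 2) :
    (c • fundMat n ζ + lam • altMat n) 0 k = rowFormula n ζ c lam k.val := by
  rw [rowFormula_eq, Matrix.add_apply, Matrix.smul_apply, Matrix.smul_apply, fundMat,
    circMat, altMat, Matrix.of_apply, Matrix.of_apply, sub_zero, ZMod.valMinAbs_def_pos, if_pos hk,
    altSign_zero, one_mul, altSign, smul_eq_mul, smul_eq_mul]
  ring

theorem combination_circulant (hne : Even n) (c lam : ℝ) (i j k : ZMod n) :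
    (c • fundMat n ζ + lam • altMat n) (i + k) (j + k) =
      (c • fundMat n ζ + lam • altMat n) i j := by
  simp only [Matrix.add_apply, Matrix.smul_apply, fundMat, circMat_add, altMat, Matrix.of_apply,
    altSign_add hne _ k, smul_eq_mul]
  linear_combination lam * altSign i * altSign j * altSign_mul_self k

/-- The matrices with the given first row. -/
theorem IsFactored.eq_combination_iff (h : IsFactored p ζ f) (c lam : ℝ) :
    (A.IsSymm ∧ (∀ i j k, A (i + k) (j + k) = A i j) ∧
      ∀ k : ZMod n, k.val ≤ n / 2 → A 0 k = rowFormula n ζ c lam k.val) ↔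
    A = c • fundMat n ζ + lam • altMat n := by
  have hs : (c • fundMat n ζ + lam • altMat n).IsSymm :=
    (h.fundMat_isSymm.smul c).add (altMat_isSymm.smul lam)
  constructor
  · rintro ⟨h1, h2, h3⟩
    exact eq_of_circulant_of_row h1 hs h2 (combination_circulant h.even c lam) fun k hk => by
      rw [h3 k hk, combination_row c lam hk]
  · rintro rfl
    exact ⟨hs, combination_circulant h.even c lam, fun k hk => combination_row c lam hk⟩

/-- If some matrix in the face does not annihilate the generating zeros, then the polynomial of the
profile has the required factorization, with positive weights. -/
theorem InFace.exists_angles (hn : 5 < n) (hne : Even n) {m : ℕ} (hnm : n = 2 * m + 4)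
    (hA : InFace f A) (hf : IsZeroProfile f) (hp : ∀ d, f d = p.coeff d.val)
    (hdeg : p.natDegree + 3 = n) (hA0 : ¬ ∀ j, A.mulVec (shifted f j) = 0) :
    ∃ ζ : Fin m → ℝ, StrictMono ζ ∧ IsFactored p ζ f ∧ ∀ j, 0 < fundWeight n ζ j := by
  obtain ⟨α, hα0, hα⟩ := hA.exists_const hn hne hf
  have hαpos : 0 < α := by
    refine hα0.lt_of_ne fun h => hA0 fun j => dotProduct_eq_zero _ fun x => ?_
    rw [dotProduct_comm, hα, ← h, zero_mul]
  -- Summing over the shifts permutes the zeros, so it stays in the face and multiplies α by n.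
  have hwit : IsCircWitness p f (CircCop.circSum A) (n * α) :=
    ⟨hn, hne, hf, hA.circSum, circSum_add A, dotProduct_circSum_mulVec_shifted hα,
      mul_pos (by exact_mod_cast NeZero.pos n) hαpos, hp, hdeg⟩
  obtain ⟨ζ, hmono, h⟩ := hwit.exists_angles hnm
  refine ⟨ζ, hmono, h, fun j => ?_⟩
  -- The original matrix A already determines the signs: its coefficient α/γ is positive, so every
  -- weight is nonnegative, and weights never vanish.
  obtain ⟨γ, lam, hγ, hAeq⟩ := h.exists_decomposition hf hA.symm hα
  rw [hAeq] at hA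
  have h1 := h.weight_nonneg hf hA j
  have h2 : 0 ≤ fundWeight n ζ j := nonneg_of_mul_nonneg_right h1 (div_pos hαpos hγ)
  refine h2.lt_of_ne' ?_
  rw [fundWeight]
  refine inv_ne_zero (mul_ne_zero (mul_ne_zero (Real.sin_pos_of_mem_Ioo (h.mem j)).ne' (h.sin_ne j))
    (Finset.prod_ne_zero_iff.2 fun l hl => ?_))
  exact sub_ne_zero.2 ((injective_cos_comp h.inj h.mem).ne (Finset.ne_of_mem_erase hl)).symm

end Cone

/-! ### Cones spanned by two independent vectors -/

section Isomorphism

theorem linearlyIsomorphic_nonnegQuadrant {V : Type*} [AddCommGroup V] [Module ℝ V] {v w : V}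
    (h : ∀ c d : ℝ, c • v + d • w = 0 → c = 0 ∧ d = 0) :
    LinearlyIsomorphic {x : V | ∃ c d : ℝ, 0 ≤ c ∧ 0 ≤ d ∧ x = c • v + d • w} nonnegQuadrant := by
  let T : (Fin 2 → ℝ) →ₗ[ℝ] V :=
    (LinearMap.proj 0).smulRight v + (LinearMap.proj 1).smulRight w
  have hT : ∀ x, T x = x 0 • v + x 1 • w := fun x => rfl
  have hinj : Function.Injective T := by
    rw [← LinearMap.ker_eq_bot, LinearMap.ker_eq_bot']
    intro x hx
    obtain ⟨h0, h1⟩ := h _ _ hx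
    funext i
    fin_cases i
    · exact h0
    · exact h1
  have himage : {x : V | ∃ c d : ℝ, 0 ≤ c ∧ 0 ≤ d ∧ x = c • v + d • w} = T '' nonnegQuadrant := by
    ext x
    constructor
    · rintro ⟨c, d, hc, hd, rfl⟩
      refine ⟨![c, d], fun i => ?_, by simp [hT]⟩
      fin_cases i
      · exact hc
      · exact hd
    · rintro ⟨y, hy, rfl⟩
      exact ⟨y 0, y 1, hy 0, hy 1, hT y⟩
  rw [himage]
  let e := Submodule.equivMapOfInjective T hinj (Submodule.span ℝ nonnegQuadrant)
  refine ⟨(LinearEquiv.ofEq _ _ (Submodule.span_image T)).trans e.symm, fun x => ?_⟩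
  set y := (LinearEquiv.ofEq _ _ (Submodule.span_image T)).trans e.symm x with hy
  have hxy : (x : V) = T y := by
    have h1 : e y = LinearEquiv.ofEq _ _ (Submodule.span_image T) x := by
      rw [hy, LinearEquiv.trans_apply, LinearEquiv.apply_symm_apply]
    have h2 := congrArg Subtype.val h1
    rw [Submodule.coe_equivMapOfInjective_apply] at h2
    rw [h2]
    rfl
  rw [hxy, hinj.mem_set_image]

end Isomorphism

/-! ### The coefficient vector as a profile on the cycle -/

section Profile

variable {n : ℕ}

/-- The coefficient vector, padded by two zeros, on the cycle. -/
def profile (u : Fin (n - 2) → ℝ) (d : ZMod n) : ℝ := if h : d.val < n - 2 then u ⟨d.val, h⟩ else 0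

theorem coeff_coeffPoly {d : ℕ} (u : Fin d → ℝ) (k : ℕ) :
    (coeffPoly u).coeff k = if h : k < d then u ⟨k, h⟩ else 0 := by
  rw [coeffPoly, finsetSum_coeff]
  simp only [coeff_C_mul, coeff_X_pow, mul_ite, mul_one, mul_zero]
  split_ifs with h
  · rw [Finset.sum_eq_single ⟨k, h⟩]
    · simp
    · intro j _ hj
      rw [if_neg]
      rintro rfl
      exact hj rfl
    · simp
  · refine Finset.sum_eq_zero fun j _ => if_neg ?_
    rintro rfl
    exact h j.isLt

theorem natDegree_coeffPoly (hn : 5 < n) {u : Fin (n - 2) → ℝ} (hpos : ∀ k, 0 < u k) :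
    (coeffPoly u).natDegree + 3 = n := by
  have h : (coeffPoly u).natDegree = n - 3 := by
    refine natDegree_eq_of_le_of_coeff_ne_zero (natDegree_le_iff_coeff_eq_zero.2 fun k hk => ?_) ?_
    · rw [coeff_coeffPoly, dif_neg (by omega)]
    · rw [coeff_coeffPoly, dif_pos (by omega)]
      exact (hpos _).ne'
  omega

theorem angleCondition_iff (hn : 5 < n) {m : ℕ} (hnm : n = 2 * m + 4) (u : Fin (n - 2) → ℝ)
    (ζ : Fin m → ℝ) :
    AngleCondition n u ζ ↔ StrictMono ζ ∧ IsFactored (coeffPoly u) ζ (profile u) ∧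
      ∀ j, 0 < fundWeight n ζ j := by
  simp only [AngleCondition, parity_iff]
  constructor
  · rintro ⟨hmono, hmem, hsign, hfac⟩
    refine ⟨hmono, ⟨hnm, by omega, hmono.injective, hmem, fun j h0 => ?_,
      fun d => (coeff_coeffPoly u _).symm, hfac⟩, fun j => (fundWeight_pos_iff hmono hmem j).2 (hsign j)⟩
    have := hsign j
    rw [h0, mul_zero] at this
    exact this.false
  · rintro ⟨hmono, h, hw⟩
    exact ⟨hmono, h.mem, fun j => (fundWeight_pos_iff hmono h.mem j).1 (hw j), h.factor⟩

variable [NeZero n]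

theorem isZeroProfile_profile (hn : 5 < n) {u : Fin (n - 2) → ℝ} (hpos : ∀ k, 0 < u k)
    (hpal : ∀ k, u k.rev = u k) : IsZeroProfile (profile u) := by
  have h1 := natCast_val_neg_one hn
  have h2 := natCast_val_neg_two hn
  have hn1 : profile u (-1) = 0 := dif_neg (by omega)
  have hn2 : profile u (-2) = 0 := dif_neg (by omega)
  refine ⟨hn1, hn2, fun d hd1 hd2 => ?_, fun d => ?_⟩
  · have := val_add_three_le hd1 hd2
    rw [profile, dif_pos (by omega)]
    exact hpos _
  · by_cases hd1 : d = -1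
    · rw [hd1, hn1, show (-3 - -1 : ZMod n) = -2 by ring, hn2]
    by_cases hd2 : d = -2
    · rw [hd2, hn2, show (-3 - -2 : ZMod n) = -1 by ring, hn1]
    have h3 := val_add_three_le hd1 hd2
    have h4 : (-3 - d : ZMod n) = ((n - 3 - d.val : ℕ) : ZMod n) := by
      have h5 : ((n - 3 - d.val + d.val + 3 : ℕ) : ZMod n) = 0 := by
        rw [show n - 3 - d.val + d.val + 3 = n by omega, ZMod.natCast_self]
      push_cast at h5
      rw [ZMod.natCast_zmod_val] at h5
      linear_combination -h5
    have h6 : (-3 - d : ZMod n).val = n - 3 - d.val := by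
      rw [h4, ZMod.val_natCast, Nat.mod_eq_of_lt (by omega)]
    have h7 : d.val < n - 2 := by omega
    rw [profile, profile, dif_pos h7, dif_pos (by omega), ← hpal]
    congr 1
    ext
    rw [Fin.val_rev]
    simp only [h6]
    omega

end Profile

/-! ### Transfer from `ZMod (k + 1)` to `Fin (k + 1)` -/

section Transport

variable {k : ℕ}

/-- `Fin (k + 1)` and `ZMod (k + 1)` agree definitionally, and so do `circulantZeros u j` and the
shifted profile. -/
theorem mem_copositiveFace_iff (u : Fin (k + 1 - 2) → ℝ)
    (A : Matrix (Fin (k + 1)) (Fin (k + 1)) ℝ) :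
    A ∈ copositiveFace (circulantZeros u) ↔ InFace (n := k + 1) (profile (n := k + 1) u) A :=
  ⟨fun h => ⟨h.1.1, h.1.2, h.2⟩, fun h => ⟨⟨h.symm, h.cop⟩, h.zero⟩⟩

theorem posSemidef_iff_real {ι : Type*} [Fintype ι] {A : Matrix ι ι ℝ} :
    A.PosSemidef ↔ A.IsSymm ∧ ∀ x : ι → ℝ, 0 ≤ x ⬝ᵥ A.mulVec x := by
  rw [Matrix.posSemidef_iff_dotProduct_mulVec, Matrix.IsHermitian,
    Matrix.conjTranspose_eq_transpose_of_trivial, Matrix.IsSymm]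
  simp only [star_trivial]

/-- Zeros of a semi-definite form are kernel vectors; conversely, annihilating the u^j allows every
vector to be moved into a window. -/
theorem mem_psdFace_iff (hk : 5 < k + 1) {u : Fin (k + 1 - 2) → ℝ}
    (hf : IsZeroProfile (profile (n := k + 1) u)) (A : Matrix (Fin (k + 1)) (Fin (k + 1)) ℝ) :
    A ∈ psdFace (circulantZeros u) ↔ InFace (n := k + 1) (profile (n := k + 1) u) A ∧
      ∀ j, Matrix.mulVec (n := ZMod (k + 1)) A (shifted (profile (n := k + 1) u) j) = 0 := by
  constructor
  · rintro ⟨hA, h0⟩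
    obtain ⟨hs, hpsd⟩ := posSemidef_iff_real.1 hA
    refine ⟨⟨hs, fun x _ => hpsd x, h0⟩, fun j => funext fun i => ?_⟩
    exact mulVec_eq_zero_of_quadForm_eq_zero (ι := ZMod (k + 1)) hs (S := Set.univ)
      (fun x _ => hpsd x) (by simp) (h0 j) (Set.mem_univ i)
  · rintro ⟨hA, h0⟩
    exact ⟨posSemidef_iff_real.2 ⟨hA.symm, hA.quadForm_nonneg_of_annihilates hk hf h0⟩, hA.zero⟩

/-- The explicit extremal matrix, with rows and columns indexed by `Fin`. -/
noncomputable def extremalMatrix (k : ℕ) {m : ℕ} (ζ : Fin m → ℝ) :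
    Matrix (Fin (k + 1)) (Fin (k + 1)) ℝ := fundMat (k + 1) ζ

theorem signMatrix_eq (k : ℕ) : signMatrix (k + 1) = altMat (k + 1) := by
  ext i j
  change (-1 : ℝ) ^ (((i : ℕ) : ℤ) - ((j : ℕ) : ℤ)) = (-1) ^ (i : ℕ) * (-1) ^ (j : ℕ)
  rw [zpow_sub₀ (by norm_num), zpow_natCast, zpow_natCast, div_eq_mul_inv, ← inv_pow]
  norm_num

theorem combination_eq {m : ℕ} (ζ : Fin m → ℝ) (c lam : ℝ) :
    c • extremalMatrix k ζ + lam • signMatrix (k + 1) =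
      c • fundMat (k + 1) ζ + lam • altMat (k + 1) :=
  congrArg (fun B : Matrix (Fin (k + 1)) (Fin (k + 1)) ℝ => c • extremalMatrix k ζ + lam • B)
    (signMatrix_eq k)

theorem signMatrix_posSemidef (k : ℕ) : (signMatrix (k + 1)).PosSemidef := by
  refine posSemidef_iff_real.2 ((signMatrix_eq k).symm ▸ ⟨altMat_isSymm (n := k + 1), fun x => ?_⟩)
  exact (sq_nonneg _).trans_eq (quadForm_altMat (n := k + 1) x).symm

theorem signMatrix_rank (k : ℕ) : (signMatrix (k + 1)).rank = 1 := by
  have h1 : signMatrix (k + 1) = Matrix.vecMulVec (fun i : Fin (k + 1) => (-1 : ℝ) ^ (i : ℕ))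
      fun j : Fin (k + 1) => (-1 : ℝ) ^ (j : ℕ) := signMatrix_eq k
  refine le_antisymm (h1 ▸ Matrix.rank_vecMulVec_le _ _) (Nat.one_le_iff_ne_zero.2 fun h0 => ?_)
  rw [Matrix.rank, Submodule.finrank_eq_zero, LinearMap.range_eq_bot] at h0
  have h2 := congrFun (LinearMap.congr_fun h0 (Pi.single 0 1)) 0
  rw [h1] at h2
  simp [Matrix.vecMulVec] at h2

variable {m : ℕ} {p : ℝ[X]} {ζ : Fin m → ℝ}

theorem hasRowFormula_iff {f : ZMod (k + 1) → ℝ}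
    (h : IsFactored p ζ f) (c lam : ℝ) (A : Matrix (Fin (k + 1)) (Fin (k + 1)) ℝ) :
    HasRowFormula ζ c lam A ↔ A = c • extremalMatrix k ζ + lam • signMatrix (k + 1) := by
  rw [combination_eq]
  refine Iff.trans ?_ (h.eq_combination_iff (A := A) c lam)
  refine and_congr Iff.rfl (and_congr Iff.rfl ⟨fun h j hj => h 0 j rfl hj, fun h i j hi hj => ?_⟩)
  have hi0 : i = 0 := Fin.ext hi
  rw [hi0]
  exact h j hj

variable {u : Fin (k + 1 - 2) → ℝ}

theorem copositiveFace_eq (hf : IsZeroProfile (profile (n := k + 1) u))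
    (h : IsFactored p ζ (profile (n := k + 1) u)) (hw : ∀ j, 0 < fundWeight (k + 1) ζ j) :
    copositiveFace (circulantZeros u) =
      {A | ∃ c lam : ℝ, 0 ≤ c ∧ 0 ≤ lam ∧
        A = c • extremalMatrix k ζ + lam • signMatrix (k + 1)} := by
  simp only [combination_eq]
  exact Set.ext fun A => (mem_copositiveFace_iff u A).trans (h.inFace_iff hf hw)

theorem psdFace_eq (hf : IsZeroProfile (profile (n := k + 1) u))
    (h : IsFactored p ζ (profile (n := k + 1) u)) (hw : ∀ j, 0 < fundWeight (k + 1) ζ j) :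
    psdFace (circulantZeros u) =
      {A | ∃ lam : ℝ, 0 ≤ lam ∧
        A = (0 : ℝ) • extremalMatrix k ζ + lam • signMatrix (k + 1)} := by
  simp only [combination_eq]
  refine Set.ext fun A => (mem_psdFace_iff h.five_lt hf A).trans ?_
  refine (and_congr (h.inFace_iff hf hw) Iff.rfl).trans ?_
  constructor
  · rintro ⟨⟨c, lam, -, hlam, rfl⟩, h0⟩
    exact ⟨lam, hlam, by rw [(h.annihilates_iff hf c lam).1 h0]⟩
  · rintro ⟨lam, hlam, rfl⟩
    exact ⟨⟨0, lam, le_rfl, hlam, rfl⟩, (h.annihilates_iff hf 0 lam).2 rfl⟩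

theorem eq_zero_of_extremalMatrix_combination (hf : IsZeroProfile (profile (n := k + 1) u))
    (h : IsFactored p ζ (profile (n := k + 1) u)) {c lam : ℝ}
    (h0 : c • extremalMatrix k ζ + lam • signMatrix (k + 1) = 0) : c = 0 ∧ lam = 0 :=
  h.eq_zero_of_combination hf ((combination_eq ζ c lam).symm.trans h0)

theorem extremalMatrix_eq_combination (k : ℕ) (ζ : Fin m → ℝ) :
    extremalMatrix k ζ = (1 : ℝ) • extremalMatrix k ζ + (0 : ℝ) • signMatrix (k + 1) := by
  rw [one_smul, zero_smul, add_zero]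

theorem extremalMatrix_mem (hf : IsZeroProfile (profile (n := k + 1) u))
    (h : IsFactored p ζ (profile (n := k + 1) u)) (hw : ∀ j, 0 < fundWeight (k + 1) ζ j) :
    extremalMatrix k ζ ∈ copositiveFace (circulantZeros u) := by
  rw [copositiveFace_eq hf h hw]
  exact ⟨1, 0, zero_le_one, le_rfl, extremalMatrix_eq_combination k ζ⟩

end Transport

end CircCop

theorem mainTheorem10 (n : ℕ) (hn : 5 < n) (hne : Even n)
    (u : Fin (n - 2) → ℝ) (hpos : ∀ k, 0 < u k) (hpal : ∀ k, u k.rev = u k) :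
    (CircCop.copositiveFace (CircCop.circulantZeros u) ≠
        CircCop.psdFace (CircCop.circulantZeros u) ↔
      ∃ ζ : Fin (n / 2 - 2) → ℝ, CircCop.AngleCondition n u ζ) ∧
    ∀ ζ : Fin (n / 2 - 2) → ℝ, CircCop.AngleCondition n u ζ →
      CircCop.LinearlyIsomorphic (CircCop.copositiveFace (CircCop.circulantZeros u))
        CircCop.nonnegQuadrant ∧
      CircCop.copositiveFace (CircCop.circulantZeros u) =
        {A | ∃ c lam : ℝ, 0 ≤ c ∧ 0 ≤ lam ∧ CircCop.HasRowFormula ζ c lam A} ∧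
      CircCop.psdFace (CircCop.circulantZeros u) =
        {A | ∃ lam : ℝ, 0 ≤ lam ∧ CircCop.HasRowFormula ζ 0 lam A} ∧
      (CircCop.signMatrix n).PosSemidef ∧ (CircCop.signMatrix n).rank = 1 ∧
      ∃ A₀ : Matrix (Fin n) (Fin n) ℝ,
        CircCop.HasRowFormula ζ 1 0 A₀ ∧
        CircCop.IsExceptional A₀ ∧
        CircCop.IsExtremalCopositive A₀ ∧
        CircCop.copositiveFace (CircCop.circulantZeros u) =
          {A | ∃ c lam : ℝ, 0 ≤ c ∧ 0 ≤ lam ∧ A = c • A₀ + lam • CircCop.signMatrix n} := by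
  obtain ⟨k, rfl⟩ : ∃ k, n = k + 1 := ⟨n - 1, by omega⟩
  have hnm : k + 1 = 2 * ((k + 1) / 2 - 2) + 4 := by
    obtain ⟨r, hr⟩ := hne
    omega
  have hf := CircCop.isZeroProfile_profile hn hpos hpal
  simp only [CircCop.angleCondition_iff hn hnm]
  refine ⟨⟨fun hneq => ?_, ?_⟩, ?_⟩
  · obtain ⟨A, hA, hA0⟩ : ∃ A, CircCop.InFace (n := k + 1) (CircCop.profile (n := k + 1) u) A ∧
        ¬ ∀ j, A.mulVec (CircCop.shifted (CircCop.profile (n := k + 1) u) j) = 0 := by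
      by_contra! hall
      refine hneq (Set.ext fun A => (CircCop.mem_copositiveFace_iff u A).trans
        (Iff.trans ?_ (CircCop.mem_psdFace_iff hn hf A).symm))
      exact ⟨fun h => ⟨h, hall A h⟩, fun h => h.1⟩
    exact hA.exists_angles hn hne hnm hf (fun d => (CircCop.coeff_coeffPoly u _).symm)
      (CircCop.natDegree_coeffPoly hn hpos) hA0
  · rintro ⟨ζ, -, h, hw⟩ heq
    -- The extremal matrix separates the two faces, being linearly independent of the sign matrix.
    have hmem := CircCop.extremalMatrix_mem hf h hw
    rw [heq, CircCop.psdFace_eq hf h hw] at hmem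
    obtain ⟨lam, -, hlam⟩ := hmem
    rw [zero_smul, zero_add] at hlam
    have h0 := CircCop.eq_zero_of_extremalMatrix_combination hf h (c := 1) (lam := -lam) (by
      rw [one_smul, neg_smul, hlam, add_neg_cancel])
    exact one_ne_zero h0.1
  · rintro ζ ⟨-, h, hw⟩
    have hmem := CircCop.extremalMatrix_mem hf h hw
    refine ⟨?_, ?_, ?_, CircCop.signMatrix_posSemidef k, CircCop.signMatrix_rank k,
      CircCop.extremalMatrix k ζ, ?_, ⟨hmem.1, ?_⟩, ⟨hmem.1, fun h0 => ?_, ?_⟩,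
      CircCop.copositiveFace_eq hf h hw⟩
    · rw [CircCop.copositiveFace_eq hf h hw]
      exact CircCop.linearlyIsomorphic_nonnegQuadrant fun c d =>
        CircCop.eq_zero_of_extremalMatrix_combination hf h
    · simp only [CircCop.hasRowFormula_iff h, CircCop.copositiveFace_eq hf h hw]
    · simp only [CircCop.hasRowFormula_iff h, CircCop.psdFace_eq hf h hw]
    · exact (CircCop.hasRowFormula_iff h 1 0 _).2 (CircCop.extremalMatrix_eq_combination k ζ)
    · rintro ⟨P, hP, N, hN, hsum⟩
      obtain ⟨hP1, hP2⟩ := CircCop.posSemidef_iff_real.1 hP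
      exact h.not_psd_add_nonneg hf hw hP1 hP2 hN.1 hN.2 hsum
    · exact (h.fundMat_zero_zero_pos hw).ne' (congrFun (congrFun h0 0) 0)
    · exact fun B hB C hC hsum => h.extremal hf hw hB.1 hB.2 hC.1 hC.2 hsum
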